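/- Let $p$ be a prime, let $G$ be a finite $p$-separable group (that is, $G$ has a normal series each of whose factors is a $p$-group or a group of order prime to $p$), and let $H$ be a $p$-complement of $G$ (a subgroup of order prime to $p$ and of $p$-power index). Let $\Gamma_p(G)$ be the graph whose vertices are the non-central conjugacy classes of $G$ consisting of elements of order not divisible by $p$, two distinct classes being adjacent if and only if their cardinalities are not coprime. Suppose that $\Gamma_p(G)$ is non-connected (it has two vertices that are not joined by a path) and contains no triangle. Then there are distinct primes $q$ and $r$, both different from $p$, such that $H$ is a quasi-Frobenius $\{q,r\}$-group (the set of prime divisors of $|H|$ is $\{q,r\}$) with abelian kernel and abelian complements. Moreover, $Z(H)=H\cap Z(G)$, and this group is either trivial or cyclic of order $2$. Here a finite group $X$ is a Frobenius group with complement $L$ if $L$ is a non-trivial proper subgroup of $X$ with $L\cap gLg^{-1}=1$ for all $g\in X\setminus L$; its kernel is the subgroup consisting of $1$ and of the elements that lie in no conjugate of $L$. A finite group $H$ is quasi-Frobenius if $H/Z(H)$ is a Frobenius group, and the kernel and the complements of $H$ are the inverse images in $H$ of the kernel and the complements of $H/Z(H)$. -/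

import Mathlib

namespace PRegularGraph

/-- A finite group `G` is `p`-separable: it has a normal series
`1 = N 0 ≤ N 1 ≤ ⋯ ≤ N n = G` each of whose factors is a `p`-group or a `p'`-group. -/
def IsPSeparable (p : ℕ) (G : Type*) [Group G] : Prop :=
  ∃ (n : ℕ) (N : ℕ → Subgroup G), N 0 = ⊥ ∧ N n = ⊤ ∧ (∀ i ≤ n, (N i).Normal) ∧
    ∀ i < n, N i ≤ N (i + 1) ∧
      ((∃ k : ℕ, (N i).relIndex (N (i + 1)) = p ^ k) ∨ ¬ p ∣ (N i).relIndex (N (i + 1)))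

/-- A `p`-complement of `G`, that is, a Hall `p'`-subgroup: a subgroup of order prime to `p`
whose index is a power of `p`. -/
def IsPComplement {G : Type*} [Group G] (p : ℕ) (H : Subgroup G) : Prop :=
  ¬ p ∣ Nat.card H ∧ ∃ k : ℕ, H.index = p ^ k

/-- The vertices of `Γ_p(G)`: the non-central conjugacy classes of `p`-regular elements
(elements of order not divisible by `p`). -/
def Vertex (p : ℕ) (G : Type*) [Group G] : Type _ :=
  {C : ConjClasses G // C ∈ ConjClasses.noncenter G ∧ ∀ g ∈ C.carrier, ¬ p ∣ orderOf g}

/-- The common divisor graph `Γ_p(G)`: two distinct non-central `p`-regular classes are adjacent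
if and only if their lengths are not coprime. -/
def commonDivisorGraph (p : ℕ) (G : Type*) [Group G] : SimpleGraph (Vertex p G) where
  Adj C D := C ≠ D ∧ ¬ Nat.Coprime (Nat.card C.1.carrier) (Nat.card D.1.carrier)
  symm := ⟨fun _ _ h => ⟨h.1.symm, fun hc => h.2 hc.symm⟩⟩
  loopless := ⟨fun _ h => h.1 rfl⟩

/-- `L` is a Frobenius complement in `G`: a non-trivial proper subgroup with `L ∩ gLg⁻¹ = 1` for
all `g ∉ L`. -/
structure IsFrobeniusComplement {G : Type*} [Group G] (L : Subgroup G) : Prop where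
  ne_bot : L ≠ ⊥
  ne_top : L ≠ ⊤
  inter_conj : ∀ g : G, g ∉ L → ∀ x ∈ L, g * x * g⁻¹ ∈ L → x = 1

/-- `G` is a Frobenius group. -/
def IsFrobenius (G : Type*) [Group G] : Prop :=
  ∃ L : Subgroup G, IsFrobeniusComplement L

/-- `K` is the Frobenius kernel of `G`: it consists of `1` and of the elements that lie in no
conjugate of a Frobenius complement. -/
def IsFrobeniusKernel {G : Type*} [Group G] (K : Subgroup G) : Prop :=
  ∃ L : Subgroup G, IsFrobeniusComplement L ∧
    ∀ x : G, x ∈ K ↔ x = 1 ∨ ∀ g : G, g * x * g⁻¹ ∉ L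

/-- `G` is quasi-Frobenius: `G / Z(G)` is a Frobenius group. -/
def IsQuasiFrobenius (G : Type*) [Group G] : Prop :=
  IsFrobenius (G ⧸ Subgroup.center G)

/-- The kernel of a quasi-Frobenius group `G`: the inverse image of the kernel of `G / Z(G)`. -/
def IsQuasiFrobeniusKernel {G : Type*} [Group G] (K : Subgroup G) : Prop :=
  ∃ K' : Subgroup (G ⧸ Subgroup.center G), IsFrobeniusKernel K' ∧
    K = K'.comap (QuotientGroup.mk' (Subgroup.center G))

/-- A complement of a quasi-Frobenius group `G`: the inverse image of a complement of
`G / Z(G)`. -/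
def IsQuasiFrobeniusComplement {G : Type*} [Group G] (L : Subgroup G) : Prop :=
  ∃ L' : Subgroup (G ⧸ Subgroup.center G), IsFrobeniusComplement L' ∧
    L = L'.comap (QuotientGroup.mk' (Subgroup.center G))

end PRegularGraph

/-! ### Class sizes, elements of prime power order and fixed points. -/

namespace PRegularGraph

open Subgroup

variable {G : Type*} [Group G]

/-! Let `b` have the largest class among the non-central elements of `H`. Call a non-central element
of prime power order, for a prime other than `p`, inner if its class lies in the component of `b`,
and outer otherwise. Inner and outer class sizes are coprime.

Outer elements are rigid. If `c` is outer and lies in `H`, then by coprimality (class of `b`)·`c'`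
lies in the class of `b * c` for each conjugate `c'` of `c`. Maximality of `b` forces equality, so
quotients of conjugates of `c` stabilize the class of `b`. That stabilizer is normal, and its order
divides the size of this class, so it centralizes `c`. Hence the conjugates of an outer `s`-element
commute and generate a normal `s`-subgroup, `s` divides the class size of `b`, and `s` divides no
outer class size (`conj_eq_mul`, `outer_mem_sylow`, `outer_not_dvd`).

The absence of triangles enters through `tri_mul`: if `x` and `y` are commuting non-central elements
of coprime prime power orders, then the classes of `x`, `y` and `x * y` form a triangle as soon as
one prime divides the class sizes of both `x` and `y`. An inner and an outer element for different
primes never commute, so a fixed point argument makes each prime divide the other class size. These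
facts give one outer prime `s`, one inner prime `r ≠ s`, and no inner `s`-elements (`outer_unique`,
`exists_inner_ne`, `inner_unique`, `not_inner`). Central translates `x`, `x * z₁`, `x * z₂` are also
potential triangles, so at most one non-trivial central element has order prime to `p`
(`center_unique`), and `H` has no third prime (`prime_dvd_card`).

All `s`-elements of `G` commute. The Sylow `r`-subgroups are abelian too, and here `p`-separability
is used (`sylow_commute`). Thus `H` is the product of a normal abelian Sylow `s`-subgroup and an
abelian Sylow `r`-subgroup whose non-central elements never commute with each other. `IsSplitPair`
derives the Frobenius structure of `H / Z(H)` from this. -/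

/-- The size of the conjugacy class of `x`, as the index of its centralizer. -/
noncomputable def classSize (x : G) : ℕ := (centralizer {x}).index

/-- `x` has `t`-power order. -/
def IsPrimary (t : ℕ) (x : G) : Prop := ∃ k, orderOf x = t ^ k

lemma mem_centralizer_single {x y : G} : y ∈ centralizer {x} ↔ Commute x y := by
  rw [mem_centralizer_singleton_iff]; exact ⟨fun h => h.symm, fun h => h.symm⟩

lemma classSize_eq_card (x : G) : classSize x = Nat.card {y // IsConj x y} := by
  have h := MulAction.index_stabilizer (ConjAct G) (x := x)
  rw [ConjAct.stabilizer_eq_centralizer] at h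
  have e : {y // IsConj x y} = (MulAction.orbit (ConjAct G) x) := by
    congr 1; ext y; rw [ConjAct.mem_orbit_conjAct, isConj_comm]
  rw [e]
  exact h

lemma classSize_eq_carrier (x : G) :
    classSize x = Nat.card (ConjClasses.mk x).carrier := by
  rw [classSize_eq_card]
  congr 1

lemma classSize_pos [Finite G] (x : G) : 0 < classSize x := Nat.pos_of_ne_zero index_ne_zero_of_finite

lemma classSize_eq_one_iff {x : G} : classSize x = 1 ↔ x ∈ center G := by
  rw [classSize, index_eq_one, mem_center_iff, eq_top_iff]
  constructor
  · intro h g; exact (mem_centralizer_single.1 (h (mem_top g))).symm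
  · intro h g _; exact mem_centralizer_single.2 (h g).symm

lemma classSize_dvd_of_commute {x y : G} (h : ∀ g, Commute x g → Commute y g) :
    classSize y ∣ classSize x :=
  index_dvd_of_le fun g hg => mem_centralizer_single.2 (h g (mem_centralizer_single.1 hg))

lemma classSize_conj {x y : G} (h : IsConj x y) : classSize x = classSize y := by
  rw [classSize_eq_card, classSize_eq_card]
  congr 1
  exact congrArg Subtype (funext fun z => propext ⟨fun k => h.symm.trans k, fun k => h.trans k⟩)

lemma orderOf_conj {x y : G} (h : IsConj x y) : orderOf x = orderOf y := by
  obtain ⟨g, rfl⟩ := isConj_iff.1 h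
  exact (MulAut.conj g).orderOf_eq x |>.symm

lemma mem_center_conj {x y : G} (h : IsConj x y) (hx : x ∈ center G) : y ∈ center G := by
  rw [← classSize_eq_one_iff] at *; rw [← classSize_conj h, hx]

lemma IsPrimary.conj {t : ℕ} {x y : G} (hx : IsPrimary t x) (h : IsConj x y) : IsPrimary t y := by
  rw [IsPrimary, ← orderOf_conj h]; exact hx

lemma isPrimary_of_pow_eq_one {t : ℕ} (ht : t.Prime) {x : G} {k : ℕ} (h : x ^ t ^ k = 1) :
    IsPrimary t x := by
  obtain ⟨m, -, hm⟩ := (Nat.dvd_prime_pow ht).1 (orderOf_dvd_of_pow_eq_one h)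
  exact ⟨m, hm⟩

lemma IsPrimary.mul {t : ℕ} (ht : t.Prime) {x y : G} (hx : IsPrimary t x) (hy : IsPrimary t y)
    (h : Commute x y) : IsPrimary t (x * y) := by
  obtain ⟨a, ha⟩ := hx
  obtain ⟨b, hb⟩ := hy
  refine isPrimary_of_pow_eq_one ht (k := a + b) ?_
  rw [h.mul_pow, orderOf_dvd_iff_pow_eq_one.1 (ha ▸ pow_dvd_pow t (Nat.le_add_right a b)),
    orderOf_dvd_iff_pow_eq_one.1 (hb ▸ pow_dvd_pow t (Nat.le_add_left b a)), one_mul]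

lemma IsPrimary.inv {t : ℕ} {x : G} (hx : IsPrimary t x) : IsPrimary t x⁻¹ := by
  rw [IsPrimary, orderOf_inv]; exact hx

lemma IsPrimary.pow {t : ℕ} (ht : t.Prime) {x : G} (hx : IsPrimary t x) (n : ℕ) :
    IsPrimary t (x ^ n) := by
  obtain ⟨a, ha⟩ := hx
  refine isPrimary_of_pow_eq_one ht (k := a) ?_
  rw [← ha, ← pow_mul, mul_comm, pow_mul, pow_orderOf_eq_one, one_pow]

lemma IsPrimary.isPGroup {t : ℕ} {x : G} (hx : IsPrimary t x) :
    IsPGroup t (zpowers x) := by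
  obtain ⟨a, ha⟩ := hx
  exact IsPGroup.of_card (n := a) (by rw [Nat.card_zpowers, ha])

lemma _root_.IsPGroup.isPrimary {t : ℕ} (ht : t.Prime) {P : Subgroup G} (hP : IsPGroup t P) {x : G}
    (hx : x ∈ P) : IsPrimary t x := by
  obtain ⟨k, hk⟩ := hP ⟨x, hx⟩
  exact isPrimary_of_pow_eq_one ht (k := k) (by simpa using congrArg Subtype.val hk)

lemma IsPrimary.coprime {s t : ℕ} (hs : s.Prime) (ht : t.Prime) (hst : s ≠ t) {x y : G}
    (hx : IsPrimary s x) (hy : IsPrimary t y) : (orderOf x).Coprime (orderOf y) := by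
  obtain ⟨a, ha⟩ := hx
  obtain ⟨b, hb⟩ := hy
  rw [ha, hb]
  exact Nat.Coprime.pow _ _ ((Nat.coprime_primes hs ht).2 hst)

lemma IsPrimary.not_dvd {s t : ℕ} (hs : s.Prime) (ht : t.Prime) (hst : s ≠ t) {x : G}
    (hx : IsPrimary s x) : ¬ t ∣ orderOf x := by
  obtain ⟨a, ha⟩ := hx
  rw [ha]
  exact fun h => hst ((Nat.prime_dvd_prime_iff_eq ht hs).1 (ht.dvd_of_dvd_pow h)).symm

lemma IsPrimary.eq_one {s t : ℕ} (hs : s.Prime) (ht : t.Prime) (hst : s ≠ t) {x : G}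
    (hx : IsPrimary s x) (hy : IsPrimary t x) : x = 1 := by
  rw [← orderOf_eq_one_iff]
  simpa using hx.coprime hs ht hst hy

lemma IsPrimary.dvd {s : ℕ} {x : G} (hx : IsPrimary s x) (h1 : x ≠ 1) : s ∣ orderOf x := by
  obtain ⟨a, ha⟩ := hx
  rcases a with _ | a
  · exact absurd (orderOf_eq_one_iff.1 (by simpa using ha)) h1
  · rw [ha]; exact dvd_pow_self _ (by omega)

/-- A `t`-subgroup fixes a point of a class of size prime to `t`. -/
lemma exists_conj_commute [Finite G] {t : ℕ} (ht : t.Prime) {P : Subgroup G} (hP : IsPGroup t P) {x : G}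
    (hx : ¬ t ∣ classSize x) : ∃ y, IsConj x y ∧ ∀ u ∈ P, Commute u y := by
  have := Fact.mk ht
  let Q : Subgroup (ConjAct G) := P.map (ConjAct.toConjAct : G ≃* ConjAct G).toMonoidHom
  have hQ : IsPGroup t Q := hP.map _
  obtain ⟨y, hy⟩ := hQ.nonempty_fixed_point_of_prime_not_dvd_card
    (MulAction.orbit (ConjAct G) x) (by
      have h := MulAction.index_stabilizer (ConjAct G) (x := x)
      rw [ConjAct.stabilizer_eq_centralizer] at h
      intro h1
      apply hx
      rw [classSize]
      rw [← Nat.card_coe_set_eq] at h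
      exact h.symm ▸ h1)
  refine ⟨y, (ConjAct.mem_orbit_conjAct.1 y.2).symm, fun u hu => ?_⟩
  have := congrArg Subtype.val (hy ⟨ConjAct.toConjAct u, mem_map_of_mem _ hu⟩)
  change ConjAct.toConjAct u • (y : G) = y at this
  rw [ConjAct.toConjAct_smul] at this
  exact mul_inv_eq_iff_eq_mul.1 this

lemma not_dvd_classSize_of_sylow [Finite G] {t : ℕ} (ht : t.Prime) (P : Sylow t G) {x : G}
    (h : ∀ u ∈ P, Commute u x) : ¬ t ∣ classSize x := by
  have := Fact.mk ht
  intro h1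
  exact P.not_dvd_index (h1.trans (index_dvd_of_le fun u hu => mem_centralizer_single.2 (h u hu).symm))

/-- Elements of `t`-power order lie in conjugates of subgroups of index prime to `t`. -/
lemma exists_conj_mem [Finite G] {t : ℕ} (ht : t.Prime) {H P : Subgroup G} (hH : ¬ t ∣ H.index)
    (hP : IsPGroup t P) : ∃ g : G, ∀ u ∈ P, g⁻¹ * u * g ∈ H := by
  have := Fact.mk ht
  obtain ⟨y, hy⟩ := hP.nonempty_fixed_point_of_prime_not_dvd_card (G ⧸ H) hH
  obtain ⟨g, rfl⟩ := QuotientGroup.mk_surjective y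
  refine ⟨g, fun u hu => ?_⟩
  have := hy ⟨u, hu⟩
  change ((u * g : G) : G ⧸ H) = g at this
  have := QuotientGroup.eq.1 this.symm
  simpa [mul_assoc] using this

lemma IsPrimary.exists_conj_mem [Finite G] {t : ℕ} (ht : t.Prime) {H : Subgroup G} (hH : ¬ t ∣ H.index)
    {x : G} (hx : IsPrimary t x) : ∃ y ∈ H, IsConj x y := by
  obtain ⟨g, hg⟩ := PRegularGraph.exists_conj_mem ht hH (hx.isPGroup)
  exact ⟨_, hg x (mem_zpowers x), isConj_iff.2 ⟨g⁻¹, by simp⟩⟩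

lemma IsPrimary.exists_conj_commute [Finite G] {t : ℕ} (ht : t.Prime) {x y : G}
    (hx : IsPrimary t x) (hy : ¬ t ∣ classSize y) : ∃ x', IsConj x x' ∧ Commute x' y := by
  obtain ⟨y', h1, h2⟩ := PRegularGraph.exists_conj_commute ht hx.isPGroup hy
  obtain ⟨g, rfl⟩ := isConj_iff.1 h1
  refine ⟨g⁻¹ * x * g⁻¹⁻¹, isConj_iff.2 ⟨g⁻¹, rfl⟩, ?_⟩
  have h3 := (h2 x (mem_zpowers x)).map (MulAut.conj g⁻¹)
  simpa [mul_assoc] using h3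

/-- A normal `t`-subgroup centralizes the elements with class size prime to `t`. -/
lemma commute_of_normal_isPGroup [Finite G] {t : ℕ} (ht : t.Prime) {P : Subgroup G} [P.Normal]
    (hP : IsPGroup t P) {x u : G} (hx : ¬ t ∣ classSize x) (hu : u ∈ P) : Commute u x := by
  obtain ⟨y, h1, h2⟩ := PRegularGraph.exists_conj_commute ht hP hx
  obtain ⟨g, rfl⟩ := isConj_iff.1 h1
  have h3 := (h2 _ (Normal.conj_mem ‹_› u hu g)).map (MulAut.conj g⁻¹)
  simpa [mul_assoc] using h3

lemma exists_primary_notMem_center [Finite G] {t : ℕ} (ht : t.Prime) {x : G} (h : t ∣ classSize x) :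
    ∃ y : G, IsPrimary t y ∧ y ∉ center G := by
  by_contra! hc
  refine not_dvd_classSize_of_sylow ht (default : Sylow t G) (x := x) (fun u hu => ?_) h
  exact (mem_center_iff.1 (hc u ((default : Sylow t G).2.isPrimary ht hu)) x).symm

/-- A non-central element has a non-central power of prime power order. -/
lemma exists_primary_pow [Finite G] {x : G} (hx : x ∉ center G) :
    ∃ t k : ℕ, t.Prime ∧ t ∣ orderOf x ∧ IsPrimary t (x ^ k) ∧ x ^ k ∉ center G := by
  have h1 : orderOf (x : G ⧸ center G) ≠ 1 := by
    rw [Ne, orderOf_eq_one_iff, QuotientGroup.eq_one_iff]; exact hx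
  obtain ⟨t, ht, htd⟩ := Nat.exists_prime_and_dvd h1
  have hd : orderOf (x : G ⧸ center G) ∣ orderOf x := orderOf_map_dvd (QuotientGroup.mk' (center G)) x
  have h0 : orderOf x ≠ 0 := (orderOf_pos x).ne'
  refine ⟨t, ordCompl[t] (orderOf x), ht, htd.trans hd, ?_, ?_⟩
  · refine isPrimary_of_pow_eq_one ht (k := (orderOf x).factorization t) ?_
    rw [← pow_mul, mul_comm, Nat.ordProj_mul_ordCompl_eq_self, pow_orderOf_eq_one]
  · intro h
    rw [← QuotientGroup.eq_one_iff, QuotientGroup.mk_pow] at h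
    exact Nat.not_dvd_ordCompl ht h0 (htd.trans (orderOf_dvd_of_pow_eq_one h))

/-- By coprimality of the orders, `x` is a power of `x * y`. -/
lemma commute_of_commute_mul {x y : G} (h : Commute x y) (hc : (orderOf x).Coprime (orderOf y))
    {g : G} (hg : Commute (x * y) g) : Commute x g := by
  obtain ⟨m, hm⟩ := exists_pow_eq_self_of_coprime hc.symm
  have : (x * y) ^ orderOf y = x ^ orderOf y := by
    rw [h.mul_pow, pow_orderOf_eq_one, mul_one]
  rw [← hm, ← this]
  exact (hg.pow_left _).pow_left _

lemma classSize_dvd_mul_left {x y : G} (h : Commute x y)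
    (hc : (orderOf x).Coprime (orderOf y)) : classSize x ∣ classSize (x * y) :=
  classSize_dvd_of_commute fun _ => commute_of_commute_mul h hc

lemma classSize_dvd_mul_right {x y : G} (h : Commute x y)
    (hc : (orderOf x).Coprime (orderOf y)) : classSize y ∣ classSize (x * y) := by
  rw [h.eq]; exact classSize_dvd_mul_left h.symm hc.symm

lemma classSize_pow_dvd (x : G) (k : ℕ) : classSize (x ^ k) ∣ classSize x :=
  classSize_dvd_of_commute fun _ h => h.pow_left k

lemma classSize_mul_center {x z : G} (hz : z ∈ center G) : classSize (x * z) = classSize x := by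
  have hz' : ∀ g, Commute z g := fun g => (mem_center_iff.1 hz g).symm
  apply Nat.dvd_antisymm
  · exact classSize_dvd_of_commute fun g h => h.mul_left (hz' g)
  · refine classSize_dvd_of_commute fun g h => ?_
    have := h.mul_left ((hz' g).inv_left)
    simpa using this

lemma classSize_inv (x : G) : classSize x⁻¹ = classSize x := Nat.dvd_antisymm
  (classSize_dvd_of_commute fun _ h => h.inv_left)
  (classSize_dvd_of_commute fun _ h => by simpa using h.inv_left)

lemma classSize_mul_comm (x y : G) : classSize (x * y) = classSize (y * x) :=
  classSize_conj (isConj_iff.2 ⟨x⁻¹, by group⟩)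

/-- The product of elements with distinct class sizes is non-central. -/
lemma mul_notMem_center {x y : G} (h : classSize x ≠ classSize y) : x * y ∉ center G := by
  intro h1
  apply h
  rw [← classSize_inv x, ← classSize_mul_center (x := x⁻¹) h1, inv_mul_cancel_left]

lemma ne_of_coprime_classSize {x y : G} (h : (classSize x).Coprime (classSize y))
    (hx : x ∉ center G) : classSize x ≠ classSize y := by
  intro e
  rw [← e, Nat.coprime_self, classSize_eq_one_iff] at h
  exact hx h

/-- A class closed under inversion and without involutions has even size. -/
lemma two_dvd_classSize [Finite G] {x : G} (h : IsConj x x⁻¹) (h2 : x ^ 2 ≠ 1) : 2 ∣ classSize x := by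
  classical
  have hinv : ∀ y z : G, IsConj y z → IsConj y⁻¹ z⁻¹ := by
    intro y z k
    obtain ⟨g, rfl⟩ := isConj_iff.1 k
    exact isConj_iff.2 ⟨g, by group⟩
  have := Fintype.ofFinite {y // IsConj x y}
  -- Inversion is an involution of the class, and it has no fixed point because no member squares to
  -- 1.
  let σ : Equiv.Perm {y // IsConj x y} :=
    { toFun := fun y => ⟨y⁻¹, h.trans (hinv _ _ y.2)⟩
      invFun := fun y => ⟨y⁻¹, h.trans (hinv _ _ y.2)⟩
      left_inv := fun y => by simp
      right_inv := fun y => by simp }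
  have hσ : σ ^ 2 = 1 := by ext y; simp [σ, pow_two]
  have hs : σ.support = Finset.univ := by
    refine Finset.eq_univ_iff_forall.2 fun y => Equiv.Perm.mem_support.2 fun hy => h2 ?_
    have h3 : (y : G)⁻¹ = y := congrArg Subtype.val hy
    have h4 : (y : G) ^ 2 = 1 := by
      rw [pow_two]; nth_rewrite 1 [← h3]; exact inv_mul_cancel _
    rw [← orderOf_dvd_iff_pow_eq_one, orderOf_conj y.2, orderOf_dvd_iff_pow_eq_one]
    exact h4
  have h3 := Equiv.Perm.two_dvd_card_support hσ
  rwa [hs, Finset.card_univ, ← Nat.card_eq_fintype_card, ← classSize_eq_card] at h3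

/-! ### Products of classes of coprime sizes, and stabilizers of classes. -/

section Coprime

variable [Finite G]

/-- A subgroup of index coprime to the size of a class is transitive on it. -/
lemma exists_conj_of_coprime_index {U : Subgroup G} {y y' : G} (h : U.index.Coprime (classSize y))
    (hy : IsConj y y') : ∃ g ∈ U, g * y * g⁻¹ = y' := by
  set Y := centralizer {y} with hY
  have h1 : Y.index ∣ Y.relIndex U := by
    have e : Y.relIndex U * U.index = U.relIndex Y * Y.index := by
      rw [← inf_relIndex_right, relIndex_mul_index inf_le_right, ← inf_relIndex_right U Y,
        relIndex_mul_index inf_le_right, inf_comm]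
    exact (Nat.Coprime.symm h).dvd_of_dvd_mul_right (Dvd.intro_left _ e.symm)
  -- The `U`-orbit of the base coset has size `Y.relIndex U`, a multiple of `Y.index`, so it fills
  -- `G ⧸ Y`; that is, `G = U Y`.
  have h2 : (MulAction.orbit U ((1 : G) : G ⧸ Y)) = Set.univ := by
    have e : MulAction.stabilizer U ((1 : G) : G ⧸ Y) = Y.subgroupOf U := by
      ext u
      rw [MulAction.mem_stabilizer_iff, mem_subgroupOf]
      change ((u * 1 : G) : G ⧸ Y) = _ ↔ _
      rw [eq_comm, QuotientGroup.eq]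
      simp
    apply Set.eq_of_subset_of_ncard_le (Set.subset_univ _) _ Set.finite_univ
    rw [Set.ncard_univ, ← MulAction.index_stabilizer, e]
    exact Nat.le_of_dvd (Nat.pos_of_ne_zero index_ne_zero_of_finite) h1
  obtain ⟨g, rfl⟩ := isConj_iff.1 hy
  obtain ⟨u, hu⟩ : (g : G ⧸ Y) ∈ MulAction.orbit U ((1 : G) : G ⧸ Y) := h2 ▸ Set.mem_univ _
  change ((u * 1 : G) : G ⧸ Y) = _ at hu
  have hc := mem_centralizer_single.1 (QuotientGroup.eq.1 hu)
  refine ⟨u, u.2, ?_⟩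
  have hc' : y = ((u : G)⁻¹ * g) * y * ((u : G)⁻¹ * g)⁻¹ := by
    rw [mul_one] at hc; rw [← hc.eq]; group
  conv_lhs => rw [hc']
  group

/-- After a conjugation `x' = x`. The centralizer of `x` is transitive on the class of `y`, so the
second factor can then be adjusted without moving `x`. -/
lemma isConj_mul_of_coprime {x y x' y' : G} (h : (classSize x).Coprime (classSize y))
    (hx : IsConj x x') (hy : IsConj y y') : IsConj (x * y) (x' * y') := by
  obtain ⟨g, rfl⟩ := isConj_iff.1 hx
  obtain ⟨k, hk, hk'⟩ := exists_conj_of_coprime_index h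
    (hy.trans (isConj_iff.2 ⟨g⁻¹, rfl⟩) : IsConj y (g⁻¹ * y' * g⁻¹⁻¹))
  refine isConj_iff.2 ⟨g * k, ?_⟩
  have e : k * x * k⁻¹ = x := by rw [← (mem_centralizer_single.1 hk).eq]; simp
  calc g * k * (x * y) * (g * k)⁻¹ = g * ((k * x * k⁻¹) * (k * y * k⁻¹)) * g⁻¹ := by group
    _ = _ := by rw [e, hk']; group

/-- Right translation by `y` embeds the class of `x` into the class of `x * y`. -/
lemma classSize_le_mul_of_coprime {x y : G} (h : (classSize x).Coprime (classSize y)) :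
    classSize x ≤ classSize (x * y) := by
  rw [classSize_eq_card, classSize_eq_card]
  exact Nat.card_le_card_of_injective
    (fun u : {z // IsConj x z} => (⟨u * y, isConj_mul_of_coprime h u.2 (IsConj.refl y)⟩ :
      {z // IsConj (x * y) z}))
    fun u v huv => Subtype.ext (mul_right_cancel (congrArg Subtype.val huv))

end Coprime

/-- The right stabilizer of a subset. -/
def rightStab (B : Set G) : Subgroup G where
  carrier := {g | ∀ b, b * g ∈ B ↔ b ∈ B}
  one_mem' := by simp
  mul_mem' {g h} hg hh b := by rw [← mul_assoc]; exact (hh _).trans (hg _)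
  inv_mem' {g} hg b := by rw [← hg (b * g⁻¹)]; simp

/-- `B` is a union of left cosets of its right stabilizer. -/
lemma card_rightStab_dvd [Finite G] (B : Set G) : Nat.card (rightStab B) ∣ Nat.card B := by
  have e : QuotientGroup.mk (s := rightStab B) ⁻¹' (QuotientGroup.mk '' B) = B := by
    ext x
    constructor
    · rintro ⟨b, hb, hbx⟩
      have := (QuotientGroup.eq.1 hbx) b
      rw [mul_inv_cancel_left] at this
      exact this.2 hb
    · exact fun hx => ⟨x, hx, rfl⟩
  have := Nat.card_congr (QuotientGroup.preimageMkEquivSubgroupProdSet (rightStab B)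
    (QuotientGroup.mk '' B))
  rw [e, Nat.card_prod] at this
  exact ⟨_, this⟩

/-- The right stabilizer of a conjugacy class. -/
def classStab (x : G) : Subgroup G := rightStab {y | IsConj x y}

instance (x : G) : (classStab x).Normal := by
  refine ⟨fun n hn g b => ?_⟩
  have h1 := hn (g⁻¹ * b * g)
  have h2 : ∀ b : G, IsConj x (g⁻¹ * b * g) ↔ IsConj x b := fun b =>
    ⟨fun h => h.trans (isConj_iff.2 ⟨g, by group⟩), fun h => h.trans (isConj_iff.2 ⟨g⁻¹, by group⟩)⟩
  have h3 := h2 (b * (g * n * g⁻¹))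
  have e : g⁻¹ * (b * (g * n * g⁻¹)) * g = g⁻¹ * b * g * n := by group
  rw [e] at h3
  simp only [Set.mem_ofPred_eq] at h1 ⊢
  rw [← h3, h1, h2]

lemma card_classStab_dvd [Finite G] (x : G) : Nat.card (classStab x) ∣ classSize x := by
  rw [classSize_eq_card]; exact card_rightStab_dvd _

/-- If class sizes are coprime and multiplication does not enlarge the class of `x`, then the
quotients of elements of the class of `c` stabilize the class of `x`. -/
lemma inv_mul_mem_classStab [Finite G] {x c c₁ c₂ : G} (h : (classSize x).Coprime (classSize c))
    (hle : classSize (x * c) ≤ classSize x) (h₁ : IsConj c c₁) (h₂ : IsConj c c₂) :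
    c₁ * c₂⁻¹ ∈ classStab x := by
  -- Translation of the class of `x` by any conjugate of `c` gives the whole class of `x * c`, so
  -- translating by `c₁` and back by `c₂` preserves the class of `x`.
  have key : ∀ c', IsConj c c' → (· * c') '' {y | IsConj x y} = {y | IsConj (x * c) y} := by
    intro c' hc'
    refine Set.eq_of_subset_of_ncard_le ?_ ?_ (Set.toFinite _)
    · rintro _ ⟨b, hb, rfl⟩
      exact isConj_mul_of_coprime h hb hc'
    · rw [Set.ncard_image_of_injective _ (mul_left_injective c'), ← Nat.card_coe_set_eq, ← Nat.card_coe_set_eq]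
      exact (classSize_eq_card (x * c)).symm.le.trans (hle.trans (classSize_eq_card x).le)
  intro b
  have k1 := key c₁ h₁
  rw [← key c₂ h₂] at k1
  constructor
  · intro hb
    have : b * (c₁ * c₂⁻¹) * c₂ ∈ (· * c₂) '' {y | IsConj x y} := ⟨_, hb, rfl⟩
    rw [← k1] at this
    obtain ⟨b', hb', e⟩ := this
    have : b' = b := by
      have e' : b' * c₁ = b * c₁ := e.trans (by group)
      exact mul_right_cancel e'
    exact this ▸ hb'
  · intro hb
    have : b * c₁ ∈ (· * c₁) '' {y | IsConj x y} := ⟨_, hb, rfl⟩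
    rw [k1] at this
    obtain ⟨b', hb', e⟩ := this
    have : b' = b * (c₁ * c₂⁻¹) := by
      have e' : b' * c₂ = b * c₁ := e
      rw [← mul_assoc, ← e']; group
    exact this ▸ hb'

lemma relIndex_dvd_index_of_normal_right [Finite G] (X K : Subgroup G) [K.Normal] :
    X.relIndex K ∣ X.index := by
  have e : X.relIndex K * K.index = K.relIndex X * X.index := by
    rw [← inf_relIndex_right, relIndex_mul_index inf_le_right,
      ← inf_relIndex_right K, relIndex_mul_index inf_le_right, inf_comm]
  obtain ⟨m, hm⟩ := relIndex_dvd_index_of_normal K X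
  have h0 : 0 < K.relIndex X := Nat.pos_of_ne_zero index_ne_zero_of_finite
  refine ⟨m, Nat.eq_of_mul_eq_mul_left h0 ?_⟩
  rw [← e, hm]; ring

/-- A normal subgroup of order coprime to a class size centralizes the class. -/
lemma commute_of_mem_normal [Finite G] {K : Subgroup G} [K.Normal] {x : G}
    (h : (Nat.card K).Coprime (classSize x)) {k : G} (hk : k ∈ K) : Commute k x := by
  have h1 : (centralizer {x}).relIndex K ∣ Nat.card K := relIndex_dvd_card _ _
  have h2 : (centralizer {x}).relIndex K ∣ classSize x := relIndex_dvd_index_of_normal_right _ _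
  have := Nat.eq_one_of_dvd_coprimes h h1 h2
  exact (mem_centralizer_single.1 (relIndex_eq_one.1 this hk)).symm

end PRegularGraph

/-! ### Inner and outer elements; rigidity of the outer ones. -/

namespace PRegularGraph

open Subgroup

variable {G : Type*} [Group G]

/-- `x` is non-central and `p`-regular: its class is a vertex of `Γ_p(G)`. -/
def IsVert (p : ℕ) (x : G) : Prop := ¬ p ∣ orderOf x ∧ x ∉ center G

/-- The data extracted from a disconnected graph `Γ_p(G)` without triangles: `A` holds for the
elements in the component of `b`, and `b` has a class of maximal size among the classes that
meet the `p`-complement `H`. -/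
structure Split (p : ℕ) (H : Subgroup G) (A : G → Prop) (b : G) : Prop where
  prime : p.Prime
  index : ∃ k, H.index = p ^ k
  tri : ∀ t : ℕ, t.Prime → ∀ x y z : G, IsVert p x → IsVert p y → IsVert p z →
    t ∣ classSize x → t ∣ classSize y → t ∣ classSize z → IsConj x y ∨ IsConj x z ∨ IsConj y z
  link : ∀ x y : G, IsVert p x → IsVert p y → ¬ (classSize x).Coprime (classSize y) → A x → A y
  b_mem : b ∈ H
  b_vert : IsVert p b
  b_inner : A b
  b_max : ∀ x ∈ H, x ∉ center G → classSize x ≤ classSize b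
  exists_not : ∃ c, IsVert p c ∧ ¬ A c

/-- A non-central element of `t`-power order in the component described by `A`. -/
structure Inner (p : ℕ) (A : G → Prop) (t : ℕ) (y : G) : Prop where
  prime : t.Prime
  ne : t ≠ p
  primary : IsPrimary t y
  notMem : y ∉ center G
  inner : A y

/-- A non-central element of `t`-power order outside the component described by `A`. -/
abbrev Outer (p : ℕ) (A : G → Prop) (t : ℕ) (y : G) : Prop := Inner p (fun x => ¬ A x) t y

lemma IsPrimary.isVert {p t : ℕ} (hp : p.Prime) (ht : t.Prime) (hne : t ≠ p) {x : G} (hx : IsPrimary t x)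
    (h : x ∉ center G) : IsVert p x := ⟨hx.not_dvd ht hp hne, h⟩

lemma not_isConj_of_primary {s t : ℕ} (hs : s.Prime) (ht : t.Prime) (hst : s ≠ t) {x y : G}
    (hx : IsPrimary s x) (hy : IsPrimary t y) (h1 : x ∉ center G) : ¬ IsConj x y := by
  intro h
  exact h1 ((hx.eq_one hs ht hst (hy.conj h.symm)) ▸ one_mem _)

lemma not_isPrimary_mul {s t : ℕ} (hs : s.Prime) (ht : t.Prime) (hst : s ≠ t) {x y : G}
    (hx : IsPrimary s x) (hy : IsPrimary t y) (h : Commute x y) (h1 : y ∉ center G) :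
    ¬ IsPrimary s (x * y) := by
  intro h2
  have : IsPrimary s y := by
    have e : y = x⁻¹ * (x * y) := by group
    rw [e]
    exact hx.inv.mul hs h2 ((Commute.refl x).mul_right h).inv_left
  exact h1 ((this.eq_one hs ht hst hy) ▸ one_mem _)

lemma exists_isConj_ne {x : G} (h : x ∉ center G) : ∃ g : G, g * x * g⁻¹ ≠ x := by
  by_contra! hc
  exact h (mem_center_iff.2 fun g => mul_inv_eq_iff_eq_mul.1 (hc g))

section

variable [Finite G] {p : ℕ} {H : Subgroup G} {A : G → Prop} {b : G}

lemma Inner.isVert (hp : p.Prime) {t : ℕ} {y : G} (h : Inner p A t y) : IsVert p y :=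
  h.primary.isVert hp h.prime h.ne h.notMem

lemma Inner.conj_of (hp : p.Prime)
    (link : ∀ x y : G, IsVert p x → IsVert p y → ¬ (classSize x).Coprime (classSize y) → A x → A y)
    {t : ℕ} {x y : G} (h : Inner p A t x) (hxy : IsConj x y) : Inner p A t y := by
  have hy : IsPrimary t y := h.primary.conj hxy
  have hn : y ∉ center G := fun k => h.notMem (mem_center_conj hxy.symm k)
  refine ⟨h.prime, h.ne, hy, hn, link x y (h.isVert hp) (hy.isVert hp h.prime h.ne hn) ?_ h.inner⟩
  rw [← classSize_conj hxy, Nat.coprime_self, classSize_eq_one_iff]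
  exact h.notMem

namespace Split

variable (S : Split p H A b)
include S

lemma link_iff {x y : G} (hx : IsVert p x) (hy : IsVert p y)
    (h : ¬ (classSize x).Coprime (classSize y)) : A x ↔ A y :=
  ⟨S.link x y hx hy h, S.link y x hy hx (fun k => h k.symm)⟩

lemma link_dvd {x y : G} (hx : IsVert p x) (hy : IsVert p y) (h : classSize x ∣ classSize y) :
    A x ↔ A y := by
  refine S.link_iff hx hy fun k => hx.2 ?_
  rw [← classSize_eq_one_iff]
  exact Nat.eq_one_of_dvd_coprimes k dvd_rfl h

lemma coprime {x y : G} (hx : IsVert p x) (hy : IsVert p y) (h1 : A x) (h2 : ¬ A y) :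
    (classSize x).Coprime (classSize y) := by
  by_contra h
  exact h2 (S.link x y hx hy h h1)

lemma inner_conj {t : ℕ} {x y : G} (h : Inner p A t x) (hxy : IsConj x y) : Inner p A t y :=
  h.conj_of S.prime S.link hxy

lemma outer_conj {t : ℕ} {x y : G} (h : Outer p A t x) (hxy : IsConj x y) : Outer p A t y :=
  Inner.conj_of S.prime (fun x y hx hy hc hA hA' =>
    hA (S.link y x hy hx (fun k => hc k.symm) hA')) h hxy

lemma coprime_io {s t : ℕ} {x y : G} (hx : Inner p A s x) (hy : Outer p A t y) :
    (classSize x).Coprime (classSize y) :=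
  S.coprime (hx.isVert S.prime) (hy.isVert S.prime) hx.inner hy.inner

lemma not_dvd_index {t : ℕ} (ht : t.Prime) (hne : t ≠ p) : ¬ t ∣ H.index := by
  obtain ⟨k, hk⟩ := S.index
  rw [hk]
  exact fun h => hne ((Nat.prime_dvd_prime_iff_eq ht S.prime).1 (ht.dvd_of_dvd_pow h))

lemma isVert_mul {s t : ℕ} (hs : s.Prime) (ht : t.Prime) (hsp : s ≠ p) (htp : t ≠ p) (hst : s ≠ t)
    {x y : G} (hx : IsPrimary s x) (hy : IsPrimary t y) (h : Commute x y) (hc : x ∉ center G) :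
    IsVert p (x * y) := by
  refine ⟨?_, fun h1 => hc ?_⟩
  · rw [h.orderOf_mul_eq_mul_orderOf_of_coprime (hx.coprime hs ht hst hy), S.prime.dvd_mul]
    exact not_or.2 ⟨hx.not_dvd hs S.prime hsp, hy.not_dvd ht S.prime htp⟩
  · rw [← classSize_eq_one_iff] at h1 ⊢
    exact Nat.dvd_one.1 (h1 ▸ classSize_dvd_mul_left h (hx.coprime hs ht hst hy))

/-- Commuting non-central elements of coprime prime power orders lie in one component. -/
lemma comm_iff {s t : ℕ} (hs : s.Prime) (ht : t.Prime) (hsp : s ≠ p) (htp : t ≠ p) (hst : s ≠ t)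
    {x y : G} (hx : IsPrimary s x) (hy : IsPrimary t y) (h : Commute x y) (hcx : x ∉ center G)
    (hcy : y ∉ center G) : (A x ↔ A (x * y)) ∧ (A y ↔ A (x * y)) := by
  have hv := S.isVert_mul hs ht hsp htp hst hx hy h hcx
  exact ⟨S.link_dvd (hx.isVert S.prime hs hsp hcx) hv
      (classSize_dvd_mul_left h (hx.coprime hs ht hst hy)),
    S.link_dvd (hy.isVert S.prime ht htp hcy) hv
      (classSize_dvd_mul_right h (hx.coprime hs ht hst hy))⟩

lemma not_commute {s t : ℕ} (hst : s ≠ t) {x y : G} (hx : Inner p A s x) (hy : Outer p A t y) :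
    ¬ Commute x y := fun h => by
  have := S.comm_iff hx.prime hy.prime hx.ne hy.ne hst hx.primary hy.primary h hx.notMem hy.notMem
  exact hy.inner (this.2.2 (this.1.1 hx.inner))

lemma exists_pow {x : G} (hx : IsVert p x) : ∃ t k : ℕ, t.Prime ∧ t ≠ p ∧ IsPrimary t (x ^ k) ∧
    x ^ k ∉ center G ∧ classSize (x ^ k) ∣ classSize x ∧ (A (x ^ k) ↔ A x) := by
  obtain ⟨t, k, ht, hd, hprim, hc⟩ := exists_primary_pow hx.2
  have htp : t ≠ p := fun h => hx.1 (h ▸ hd)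
  exact ⟨t, k, ht, htp, hprim, hc, classSize_pow_dvd x k,
    S.link_dvd (hprim.isVert S.prime ht htp hc) hx (classSize_pow_dvd x k)⟩

lemma exists_outer : ∃ s c, Outer p A s c := by
  obtain ⟨c, hc, hA⟩ := S.exists_not
  obtain ⟨t, k, ht, htp, h1, h2, -, h3⟩ := S.exists_pow hc
  exact ⟨t, c ^ k, ht, htp, h1, h2, fun h => hA (h3.1 h)⟩

lemma exists_inner : ∃ s y, Inner p A s y := by
  obtain ⟨t, k, ht, htp, h1, h2, -, h3⟩ := S.exists_pow S.b_vert
  exact ⟨t, b ^ k, ht, htp, h1, h2, h3.2 S.b_inner⟩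

lemma coprime_b {t : ℕ} {c : G} (hc : Outer p A t c) : (classSize b).Coprime (classSize c) :=
  S.coprime S.b_vert (hc.isVert S.prime) S.b_inner hc.inner

/-- This is where maximality of `b` is used: a conjugate `c₀` of `c` lies in `H`, so `b * c₀` is a
non-central element of `H` and its class is no larger than that of `b`. -/
lemma mul_inv_mem {t : ℕ} {c c₁ : G} (hc : Outer p A t c) (h : IsConj c c₁) :
    c₁ * c⁻¹ ∈ classStab b := by
  obtain ⟨c₀, hc₀, h₀⟩ := hc.primary.exists_conj_mem hc.prime (S.not_dvd_index hc.prime hc.ne)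
  have ho := S.outer_conj hc h₀
  refine inv_mul_mem_classStab (S.coprime_b ho) (S.b_max _ (mul_mem S.b_mem hc₀) fun h1 => ?_)
    (h₀.symm.trans h) h₀.symm
  exact mul_notMem_center (ne_of_coprime_classSize (S.coprime_b ho) S.b_vert.2) h1

lemma commute_stab {t : ℕ} {c k : G} (hc : Outer p A t c) (hk : k ∈ classStab b) : Commute k c :=
  commute_of_mem_normal (Nat.Coprime.coprime_dvd_left (card_classStab_dvd b) (S.coprime_b hc)) hk

/-- The factor `k` commutes with `c`, so it is a quotient of two commuting `t`-elements and is
itself one. -/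
lemma conj_eq_mul {t : ℕ} {c : G} (hc : Outer p A t c) (g : G) :
    ∃ k ∈ classStab b, IsPrimary t k ∧ g * c * g⁻¹ = c * k := by
  have hg : IsConj c (g * c * g⁻¹) := isConj_iff.2 ⟨g, rfl⟩
  have hk := S.mul_inv_mem hc hg
  refine ⟨_, hk, ?_, ?_⟩
  · have hcomm := S.commute_stab hc hk
    refine (hc.primary.conj hg).mul hc.prime hc.primary.inv ?_
    have h2 := hcomm.mul_left (Commute.refl c)
    simp only [inv_mul_cancel_right] at h2
    exact h2.inv_right
  · rw [← (S.commute_stab hc hk).eq]; group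

/-- A conjugate of `c` other than `c` yields a non-trivial `t`-element in `classStab b`, whose order
divides the class size of `b`. -/
lemma dvd_classSize_b {t : ℕ} {c : G} (hc : Outer p A t c) : t ∣ classSize b := by
  obtain ⟨g, hg⟩ := exists_isConj_ne hc.notMem
  obtain ⟨k, hk, hk1, hk2⟩ := S.conj_eq_mul hc g
  have hk3 : k ≠ 1 := fun h => hg (by rw [hk2, h, mul_one])
  refine (hk1.dvd hk3).trans (dvd_trans ?_ (card_classStab_dvd b))
  exact dvd_trans (by rw [Subgroup.orderOf_mk]) (orderOf_dvd_natCard (⟨k, hk⟩ : classStab b))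

lemma outer_not_dvd {s t : ℕ} {c d : G} (hc : Outer p A s c) (hd : Outer p A t d) :
    ¬ s ∣ classSize d := fun h => hc.prime.one_lt.ne'
  (Nat.eq_one_of_dvd_coprimes (S.coprime_b hd) (S.dvd_classSize_b hc) h)

/-- The commutator of `c` and `d` is, up to inversion, both an `s`-element and a `t`-element. -/
lemma outer_commute {s t : ℕ} (hst : s ≠ t) {c d : G} (hc : Outer p A s c) (hd : Outer p A t d) :
    Commute c d := by
  obtain ⟨k, hk, hk1, hk2⟩ := S.conj_eq_mul hc d
  obtain ⟨l, hl, hl1, hl2⟩ := S.conj_eq_mul hd c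
  have e : k * l = 1 := by
    have h1 : d * c * d⁻¹ * c⁻¹ = k := by
      rw [hk2, (S.commute_stab hc hk).symm.eq]; group
    have h2 : c * d * c⁻¹ * d⁻¹ = l := by
      rw [hl2, (S.commute_stab hd hl).symm.eq]; group
    rw [← h1, ← h2]; group
  have : k = 1 := hk1.eq_one hc.prime hd.prime hst (by rw [eq_inv_of_mul_eq_one_left e]; exact hl1.inv)
  rw [this, mul_one, mul_inv_eq_iff_eq_mul] at hk2
  exact hk2.symm

/-- Conjugates of `c` differ by elements centralizing outer elements, so they commute. They generate
a normal `s`-subgroup, which lies in every Sylow `s`-subgroup. -/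
lemma outer_mem_sylow {s : ℕ} {c : G} (hc : Outer p A s c) (P : Sylow s G) : c ∈ P := by
  have := Fact.mk hc.prime
  set X : Set G := {x | IsConj c x} with hX
  have hcomm : ∀ x ∈ X, ∀ y ∈ X, x * y = y * x := by
    intro x hx y hy
    have hx' := S.outer_conj hc hx
    have hy' := S.outer_conj hc hy
    obtain ⟨g, rfl⟩ := isConj_iff.1 (hx.symm.trans hy : IsConj x y)
    obtain ⟨k, hk, -, hk2⟩ := S.conj_eq_mul hx' g
    rw [hk2]
    exact (Commute.refl x).mul_right (S.commute_stab hx' hk).symm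
  have hJc := Subgroup.isMulCommutative_closure hcomm
  have hJp : IsPGroup s (closure X) := by
    rintro ⟨x, hx⟩
    obtain ⟨n, hn⟩ := hc.primary
    refine ⟨n, Subtype.ext ?_⟩
    change x ^ s ^ n = 1
    induction hx using closure_induction with
    | mem x hx => rw [← hn, orderOf_conj hx, pow_orderOf_eq_one]
    | one => exact one_pow _
    | mul x y hx hy h1 h2 =>
      have : Commute x y := congrArg Subtype.val (hJc.is_comm.comm ⟨x, hx⟩ ⟨y, hy⟩)
      rw [this.mul_pow, h1, h2, one_mul]
    | inv x hx h1 => rw [inv_pow, h1, inv_one]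
  have hJn : (closure X).Normal := by
    refine ⟨fun x hx g => ?_⟩
    induction hx using closure_induction with
    | mem x hx => exact subset_closure (hx.trans (isConj_iff.2 ⟨g, rfl⟩) : IsConj c _)
    | one => simp
    | mul x y _ _ h1 h2 =>
      have : g * (x * y) * g⁻¹ = (g * x * g⁻¹) * (g * y * g⁻¹) := by group
      rw [this]; exact mul_mem h1 h2
    | inv x _ h1 =>
      have : g * x⁻¹ * g⁻¹ = (g * x * g⁻¹)⁻¹ := by group
      rw [this]; exact inv_mem h1
  have h1 : closure X ≤ P := by
    have := P.3 (P.2.to_sup_of_normal_right hJp) le_sup_left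
    exact this ▸ le_sup_right
  exact h1 (subset_closure (IsConj.refl c))

end Split

end

end PRegularGraph

/-! ### Consequences of having no triangle: a single outer prime, and a second prime for inner
elements. -/

namespace PRegularGraph

open Subgroup
open scoped commutatorElement

variable {G : Type*} [Group G]

/-- The commutator subgroup of a finite nilpotent group consists of non-generators. -/
lemma eq_top_of_sup_commutator {N : Type*} [Group N] [Finite N] [Group.IsNilpotent N]
    {X : Subgroup N} (h : X ⊔ commutator N = ⊤) : X = ⊤ := by
  by_contra hX
  obtain ⟨M, hM, hXM⟩ := (eq_top_or_exists_le_coatom X).resolve_left hX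
  -- A maximal subgroup of a nilpotent group is normal; the commutator subgroup of the solvable
  -- quotient is proper, hence trivial by maximality.
  have hn : M.Normal := Group.normalizerCondition_of_isNilpotent.normal_of_coatom M hM
  have hnt : Nontrivial (N ⧸ M) := QuotientGroup.nontrivial_iff.2 hM.1
  have h1 := Group.IsSolvable.commutator_lt_top_of_nontrivial (N ⧸ M)
  have h2 : M ≤ (commutator (N ⧸ M)).comap (QuotientGroup.mk' M) := by
    intro x hx
    rw [mem_comap, QuotientGroup.mk'_apply, (QuotientGroup.eq_one_iff x).2 hx]
    exact one_mem _
  have h3 : commutator N ≤ (commutator (N ⧸ M)).comap (QuotientGroup.mk' M) := by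
    rw [← map_le_iff_le_comap, commutator_def, map_commutator, commutator_def]
    exact commutator_mono le_top le_top
  have hM' : commutator N ≤ M := by
    rcases hM.le_iff.1 h2 with h4 | h4
    · rw [← comap_top (QuotientGroup.mk' M)] at h4
      exact absurd (comap_injective (QuotientGroup.mk'_surjective M) h4) h1.ne
    · exact h4 ▸ h3
  exact hM.1 (top_le_iff.1 (h ▸ sup_le hXM hM'))

lemma eq_top_or_eq_top_of_forall_mem {N : Type*} [Group N] {X Y : Subgroup N}
    (h : ∀ x, x ∈ X ∨ x ∈ Y) : X = ⊤ ∨ Y = ⊤ := by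
  by_contra! hc
  obtain ⟨a, ha⟩ : ∃ a, a ∉ X := by
    by_contra! k; exact hc.1 (top_le_iff.1 fun a _ => k a)
  obtain ⟨b, hb⟩ : ∃ b, b ∉ Y := by
    by_contra! k; exact hc.2 (top_le_iff.1 fun a _ => k a)
  have ha' := (h a).resolve_left ha
  have hb' := (h b).resolve_right hb
  rcases h (a * b) with h1 | h1
  · exact ha ((mul_mem_cancel_right hb').1 h1)
  · exact hb ((mul_mem_cancel_left ha').1 h1)

namespace Split

variable [Finite G] {p : ℕ} {H : Subgroup G} {A : G → Prop} {b : G} (S : Split p H A b)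
include S

lemma tri_mul {s t : ℕ} (hs : s.Prime) (ht : t.Prime) (hsp : s ≠ p) (htp : t ≠ p) (hst : s ≠ t)
    {x y : G} (hx : IsPrimary s x) (hy : IsPrimary t y) (h : Commute x y) (hcx : x ∉ center G)
    (hcy : y ∉ center G) {q : ℕ} (hq : q.Prime) (h1 : q ∣ classSize x) (h2 : q ∣ classSize y) :
    False := by
  rcases S.tri q hq x y (x * y) (hx.isVert S.prime hs hsp hcx) (hy.isVert S.prime ht htp hcy)
    (S.isVert_mul hs ht hsp htp hst hx hy h hcx) h1 h2
    (h1.trans (classSize_dvd_mul_left h (hx.coprime hs ht hst hy))) with k | k | k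
  · exact not_isConj_of_primary hs ht hst hx hy hcx k
  · exact not_isPrimary_mul hs ht hst hx hy h hcy (hx.conj k)
  · rw [h.eq] at k
    exact not_isPrimary_mul ht hs hst.symm hy hx h.symm hcx (hy.conj k)

/-- Otherwise an `s`-subgroup fixes a point of the class of `c`, so some conjugate of `x` commutes
with `c`, against `not_commute`. -/
lemma inner_dvd_outer {s t : ℕ} (hst : s ≠ t) {x c : G} (hx : Inner p A s x) (hc : Outer p A t c) :
    s ∣ classSize c := by
  by_contra h
  obtain ⟨x', h1, h2⟩ := hx.primary.exists_conj_commute hx.prime h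
  exact S.not_commute hst (S.inner_conj hx h1) hc h2

lemma outer_dvd_inner {s t : ℕ} (hst : s ≠ t) {x c : G} (hx : Inner p A s x) (hc : Outer p A t c) :
    t ∣ classSize x := by
  by_contra h
  obtain ⟨c', h1, h2⟩ := hc.primary.exists_conj_commute hc.prime h
  exact S.not_commute hst hx (S.outer_conj hc h1) h2.symm

lemma inner_or_outer {w : ℕ} (hw : w.Prime) (hwp : w ≠ p) {x : G} (hx : IsPrimary w x)
    (h : x ∉ center G) : Inner p A w x ∨ Outer p A w x := by
  by_cases hA : A x
  · exact Or.inl ⟨hw, hwp, hx, h, hA⟩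
  · exact Or.inr ⟨hw, hwp, hx, h, hA⟩

omit S [Finite G] in
lemma exists_prime_dvd {x : G} (h : x ∉ center G) : ∃ w, w.Prime ∧ w ∣ classSize x :=
  Nat.exists_prime_and_dvd fun h1 => h (classSize_eq_one_iff.1 h1)

/-- All elements of prime power order outside the component of `b` belong to one prime. -/
lemma outer_unique {s t : ℕ} {c d : G} (hc : Outer p A s c) (hd : Outer p A t d) : s = t := by
  by_contra hst
  have hcd := S.outer_commute hst hc hd
  have tri := fun {q : ℕ} (hq : q.Prime) (h1 : q ∣ classSize c) (h2 : q ∣ classSize d) =>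
    S.tri_mul hc.prime hd.prime hc.ne hd.ne hst hc.primary hd.primary hcd hc.notMem hd.notMem hq h1 h2
  -- An inner prime other than `s` and `t` would divide the class sizes of both `c` and `d`.
  have hu : ∀ u y, Inner p A u y → u = s ∨ u = t := by
    intro u y hy
    by_contra! h
    exact tri hy.prime (S.inner_dvd_outer h.1 hy hc) (S.inner_dvd_outer h.2 hy hd)
  -- Every prime other than `p` that divides a class size has non-central elements, so it is now an
  -- outer prime, and outer primes divide no outer class size.
  have hp : ∀ v e, Outer p A v e → p ∣ classSize e := by
    intro v e he
    obtain ⟨w, hw, hwd⟩ := exists_prime_dvd he.notMem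
    by_cases hwp : w = p
    · rwa [← hwp]
    obtain ⟨x, hx, hxc⟩ := exists_primary_notMem_center hw hwd
    rcases S.inner_or_outer hw hwp hx hxc with h | h
    · rcases hu w x h with rfl | rfl
      · exact absurd hwd (S.outer_not_dvd hc he)
      · exact absurd hwd (S.outer_not_dvd hd he)
    · exact absurd hwd (S.outer_not_dvd h he)
  exact tri S.prime (hp s c hc) (hp t d hd)

lemma inner_of_ne {s w : ℕ} {c : G} (hc : Outer p A s c) (hw : w.Prime) (hwp : w ≠ p) (hws : w ≠ s)
    {x : G} (hx : IsPrimary w x) (h : x ∉ center G) : Inner p A w x :=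
  (S.inner_or_outer hw hwp hx h).resolve_right fun h1 => hws (S.outer_unique h1 hc)

/-- The component of `b` contains elements whose order is a power of a second prime. -/
lemma exists_inner_ne {s : ℕ} {c : G} (hc : Outer p A s c) : ∃ r y, r ≠ s ∧ Inner p A r y := by
  by_contra! hcon
  have hs := Fact.mk hc.prime
  have hp := Fact.mk S.prime
  have hprime : ∀ (w : ℕ) (x : G), w.Prime → w ∣ classSize x → w = p ∨ w = s := by
    intro w x hw hd
    by_contra! h
    obtain ⟨y, hy, hyc⟩ := exists_primary_notMem_center hw hd
    exact hcon w y h.2 (S.inner_of_ne hc hw h.1 h.2 hy hyc)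
  have hout : ∀ d, Outer p A s d → p ∣ classSize d := by
    intro d hd
    obtain ⟨w, hw, hwd⟩ := exists_prime_dvd hd.notMem
    rcases hprime w d hw hwd with rfl | rfl
    · exact hwd
    · exact absurd hwd (S.outer_not_dvd hd hd)
  have hin : ∀ x, Inner p A s x → ∀ w, w.Prime → w ∣ classSize x → w = s := by
    intro x hx w hw hwd
    refine (hprime w x hw hwd).resolve_left ?_
    rintro rfl
    exact hw.one_lt.ne' (Nat.eq_one_of_dvd_coprimes (S.coprime_io hx hc) hwd (hout c hc))
  obtain ⟨u, y, hy⟩ := S.exists_inner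
  obtain rfl : u = s := by
    by_contra h; exact hcon u y h hy
  let P : Sylow u G := default
  -- Inner class sizes of `u`-elements are powers of `u`, so `P` is transitive on these classes.
  have hPcop : ∀ x, Inner p A u x → (P : Subgroup G).index.Coprime (classSize x) := by
    intro x hx
    refine Nat.Coprime.symm (Nat.coprime_of_dvd fun w hw h1 h2 => ?_)
    rw [hin x hx w hw h1] at h2
    exact P.not_dvd_index h2
  have hPn : (P : Subgroup G).Normal := by
    refine ⟨fun x hx g => ?_⟩
    have hcon : IsConj x (g * x * g⁻¹) := isConj_iff.2 ⟨g, rfl⟩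
    by_cases hxc : x ∈ center G
    · rw [mem_center_iff.1 hxc g, mul_inv_cancel_right]; exact hx
    rcases S.inner_or_outer hc.prime hc.ne (P.2.isPrimary hc.prime hx) hxc with h | h
    · obtain ⟨v, hv, hv'⟩ := exists_conj_of_coprime_index (hPcop x h) hcon
      rw [← hv']
      exact mul_mem (mul_mem hv hx) (inv_mem hv)
    · exact S.outer_mem_sylow (S.outer_conj h hcon) P
  let Q : Sylow p G := default
  let D : Subgroup P := (centralizer (Q : Set G)).subgroupOf P
  have hnil : Group.IsNilpotent P := P.2.isNilpotent
  -- Outer elements of `P` are central in `P`. An inner one is `P`-conjugate to an element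
  -- centralizing `Q`, hence congruent to it modulo the commutator subgroup. So `P` is a union of
  -- two subgroups: either `P` is abelian, against the class size of `y`, or `Q` centralizes `c`,
  -- against `hout`.
  have hmem : ∀ x : P, x ∈ center P ⊔ commutator P ∨ x ∈ D ⊔ commutator P := by
    rintro ⟨x, hx⟩
    by_cases hxc : x ∈ center G
    · exact Or.inl (mem_sup_left (mem_center_iff.2 fun g => Subtype.ext (mem_center_iff.1 hxc g)))
    rcases S.inner_or_outer hc.prime hc.ne (P.2.isPrimary hc.prime hx) hxc with h | h
    · right
      obtain ⟨x', h1, h2⟩ := exists_conj_commute S.prime Q.2 (x := x)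
        (fun hd => hc.ne (hin x h p S.prime hd).symm)
      obtain ⟨v, hv, rfl⟩ := exists_conj_of_coprime_index (hPcop x h) h1
      have e : (⟨x, hx⟩ : P) = (⟨v, hv⟩ * ⟨x, hx⟩ * ⟨v, hv⟩⁻¹) *
          ⁅(⟨v, hv⟩ * ⟨x, hx⟩ * ⟨v, hv⟩⁻¹ : P)⁻¹, (⟨v, hv⟩ : P)⁻¹⁆ := by
        rw [commutatorElement_def]; group
      rw [e]
      refine mul_mem (mem_sup_left ?_) (mem_sup_right (commutator_mem_commutator (mem_top _) (mem_top _)))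
      rw [mem_subgroupOf, mem_centralizer_iff]
      exact fun u hu => h2 u hu
    · left
      refine mem_sup_left (mem_center_iff.2 fun g => Subtype.ext ?_)
      exact commute_of_normal_isPGroup hc.prime P.2 (S.outer_not_dvd hc h) g.2
  rcases eq_top_or_eq_top_of_forall_mem hmem with h | h
  · have hZ := eq_top_of_sup_commutator h
    have hyP : y ∈ P := by
      obtain ⟨y', hy', h1⟩ := hy.primary.exists_conj_mem hc.prime P.not_dvd_index
      obtain ⟨g, rfl⟩ := isConj_iff.1 h1.symm
      exact hPn.conj_mem _ hy' g
    refine not_dvd_classSize_of_sylow hc.prime P (x := y) (fun v hv => ?_) ?_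
    · have : (⟨y, hyP⟩ : P) ∈ center P := hZ ▸ mem_top _
      exact congrArg Subtype.val (mem_center_iff.1 this ⟨v, hv⟩)
    · obtain ⟨w, hw, hwd⟩ := exists_prime_dvd hy.notMem
      rwa [← hin y hy w hw hwd]
  · have hD := eq_top_of_sup_commutator h
    refine not_dvd_classSize_of_sylow S.prime Q (x := c) (fun v hv => ?_) (hout c hc)
    have : (⟨c, S.outer_mem_sylow hc P⟩ : P) ∈ D := hD ▸ mem_top _
    exact mem_centralizer_iff.1 (mem_subgroupOf.1 this) v hv

end Split

end PRegularGraph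

/-! ### No inner `s`-elements; the central elements; the primes of `H`. -/

namespace PRegularGraph

open Subgroup

variable {G : Type*} [Group G]

namespace Split

variable [Finite G] {p : ℕ} {H : Subgroup G} {A : G → Prop} {b : G} (S : Split p H A b)
include S

/-- Apart from `p` and the prime of the outer elements, only one prime has non-central elements. -/
lemma inner_unique {s r w : ℕ} {c y x : G} (hc : Outer p A s c) (hr : r ≠ s) (hy : Inner p A r y)
    (hws : w ≠ s) (hx : Inner p A w x) : w = r := by
  by_contra hwr
  have h1 : ¬ w ∣ classSize y := fun h => hx.prime.one_lt.ne'
    (Nat.eq_one_of_dvd_coprimes (S.coprime_io hy hc) h (S.inner_dvd_outer hws hx hc))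
  obtain ⟨x', h2, h3⟩ := hx.primary.exists_conj_commute hx.prime h1
  have hx' := S.inner_conj hx h2
  exact S.tri_mul hx.prime hy.prime hx.ne hy.ne hwr hx'.primary hy.primary h3 hx'.notMem hy.notMem
    hc.prime (S.outer_dvd_inner hws hx' hc) (S.outer_dvd_inner hr hy hc)

lemma prime_dvd_classSize {s r : ℕ} {c y : G} (hc : Outer p A s c) (hr : r ≠ s) (hy : Inner p A r y)
    {w : ℕ} (hw : w.Prime) {x : G} (h : w ∣ classSize x) : w = p ∨ w = s ∨ w = r := by
  by_contra! hcon
  obtain ⟨u, hu, huc⟩ := exists_primary_notMem_center hw h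
  exact hcon.2.2 (S.inner_unique hc hr hy hcon.2.1 (S.inner_of_ne hc hw hcon.1 hcon.2.1 hu huc))

lemma inner_primes {s r : ℕ} {c y : G} (hc : Outer p A s c) (hr : r ≠ s) (hy : Inner p A r y)
    {x : G} (hx : Inner p A s x) :
    (∃ y', Inner p A r y' ∧ Commute x y') ∧ (¬ s ∣ classSize x) ∧ ¬ r ∣ classSize x ∧
      p ∣ classSize x := by
  have h1 : ¬ r ∣ classSize x := fun h => hy.prime.one_lt.ne'
    (Nat.eq_one_of_dvd_coprimes (S.coprime_io hx hc) h (S.inner_dvd_outer hr hy hc))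
  obtain ⟨y', h2, h3⟩ := hy.primary.exists_conj_commute hy.prime h1
  have hy' := S.inner_conj hy h2
  have h4 : ¬ s ∣ classSize x := fun h =>
    S.tri_mul hx.prime hy.prime hx.ne hy.ne hr.symm hx.primary hy'.primary h3.symm hx.notMem
      hy'.notMem hc.prime h (S.outer_dvd_inner hr hy' hc)
  refine ⟨⟨y', hy', h3.symm⟩, h4, h1, ?_⟩
  obtain ⟨w, hw, hwd⟩ := exists_prime_dvd hx.notMem
  rcases S.prime_dvd_classSize hc hr hy hw hwd with rfl | rfl | rfl
  · exact hwd
  · exact absurd hwd h4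
  · exact absurd hwd h1

/-- The component of `b` contains no elements of `s`-power order, where `s` is the prime of the
outer elements. -/
lemma not_inner {s r : ℕ} {c y : G} (hc : Outer p A s c) (hr : r ≠ s) (hy : Inner p A r y)
    (x : G) : ¬ Inner p A s x := by
  intro hx₀
  obtain ⟨x, hx₁, hxc⟩ := hx₀.primary.exists_conj_commute hc.prime (S.outer_not_dvd hc hc)
  have hx := S.inner_conj hx₀ hx₁
  have hcop := S.coprime_io hx hc
  have hn : x * c ∉ center G := mul_notMem_center (ne_of_coprime_classSize hcop hx.notMem)
  have hprim : IsPrimary s (x * c) := hx.primary.mul hc.prime hc.primary hxc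
  obtain ⟨⟨y', hy', hxy⟩, h1, h2, h3⟩ := S.inner_primes hc hr hy hx
  -- If `x * c` is inner, then `p` divides the class sizes of `x`, `x * c` and `x * y'`, which
  -- forces `x` and `x * c` to be conjugate. Multiplying by `c` then does not enlarge the class of
  -- `x`, and an `s`-element of `classStab x` contradicts `h1`. If `x * c` is outer, the roles of
  -- `x` and `c` are exchanged.
  rcases S.inner_or_outer hc.prime hc.ne hprim hn with h | h
  · have h4 := (S.inner_primes hc hr hy h).2.2.2
    have hnot : ¬ IsPrimary s (x * y') :=
      not_isPrimary_mul hx.prime hy'.prime hr.symm hx.primary hy'.primary hxy hy'.notMem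
    have hconj : IsConj x (x * c) := by
      rcases S.tri p S.prime x (x * c) (x * y') (hx.isVert S.prime) (h.isVert S.prime)
        (S.isVert_mul hx.prime hy'.prime hx.ne hy'.ne hr.symm hx.primary hy'.primary hxy hx.notMem)
        h3 h4 (h3.trans (classSize_dvd_mul_left hxy
          (hx.primary.coprime hx.prime hy'.prime hr.symm hy'.primary))) with k | k | k
      · exact k
      · exact absurd (hx.primary.conj k) hnot
      · exact absurd (hprim.conj k) hnot
    obtain ⟨g, hg⟩ := exists_isConj_ne hc.notMem
    have hk := inv_mul_mem_classStab hcop (classSize_conj hconj).ge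
      (isConj_iff.2 ⟨g, rfl⟩ : IsConj c (g * c * g⁻¹)) (IsConj.refl c)
    obtain ⟨k, hk1, hk2, hk3⟩ := S.conj_eq_mul hc g
    have hk4 : k ≠ 1 := fun e => hg (by rw [hk3, e, mul_one])
    rw [hk3, ← (S.commute_stab hc hk1).eq, mul_inv_cancel_right] at hk
    refine h1 ((hk2.dvd hk4).trans (dvd_trans ?_ (card_classStab_dvd x)))
    exact dvd_trans (by rw [Subgroup.orderOf_mk]) (orderOf_dvd_natCard (⟨k, hk⟩ : classStab x))
  · have hle : classSize (c * x) ≤ classSize c := by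
      have h4 := S.coprime_io hx h
      rw [← classSize_mul_comm x c]
      -- `c` is the product of `x * c` and `x⁻¹`, whose class sizes are coprime.
      have h5 := classSize_le_mul_of_coprime (x := x * c) (y := x⁻¹)
        (by rw [classSize_inv]; exact h4.symm)
      rwa [hxc.eq, mul_inv_cancel_right, ← hxc.eq] at h5
    have hM : IsPGroup r (classStab c) := by
      refine IsPGroup.of_card (n := (Nat.card (classStab c)).primeFactorsList.length) ?_
      refine Nat.eq_prime_pow_of_unique_prime_dvd Nat.card_pos.ne' fun {w} hw hwd => ?_
      have hwd' := hwd.trans (card_classStab_dvd c)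
      rcases S.prime_dvd_classSize hc hr hy hw hwd' with rfl | rfl | rfl
      · exact absurd (Nat.eq_one_of_dvd_coprimes hcop h3 hwd') hw.one_lt.ne'
      · exact absurd hwd' (S.outer_not_dvd hc hc)
      · rfl
    obtain ⟨g, hg⟩ := exists_isConj_ne hx.notMem
    have hconj : IsConj x (g * x * g⁻¹) := isConj_iff.2 ⟨g, rfl⟩
    have hm := inv_mul_mem_classStab hcop.symm hle hconj (IsConj.refl x)
    have hcomm := commute_of_normal_isPGroup hy.prime hM h2 hm
    have h6 : IsPrimary s (g * x * g⁻¹ * x⁻¹) := by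
      refine (hx.primary.conj hconj).mul hx.prime hx.primary.inv ?_
      have h7 := hcomm.mul_left (Commute.refl x)
      rw [inv_mul_cancel_right] at h7
      exact h7.inv_right
    exact hg (mul_inv_eq_one.1 (h6.eq_one hx.prime hy.prime hr.symm (hM.isPrimary hy.prime hm)))

lemma outer_of_notMem {s r : ℕ} {c y : G} (hc : Outer p A s c) (hr : r ≠ s) (hy : Inner p A r y)
    {x : G} (hx : IsPrimary s x) (h : x ∉ center G) : Outer p A s x :=
  (S.inner_or_outer hc.prime hc.ne hx h).resolve_left (S.not_inner hc hr hy x)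

/-- Non-central `s`-elements are now all outer, so they lie in every Sylow `s`-subgroup, while a
conjugate of each is centralized by such a subgroup. -/
lemma commute_of_primary {s r : ℕ} {c y : G} (hc : Outer p A s c) (hr : r ≠ s) (hy : Inner p A r y)
    {x x' : G} (hx : IsPrimary s x) (hx' : IsPrimary s x') : Commute x x' := by
  have := Fact.mk hc.prime
  by_cases h : x ∈ center G
  · exact (mem_center_iff.1 h x').symm
  by_cases h' : x' ∈ center G
  · exact mem_center_iff.1 h' x
  have ho := S.outer_of_notMem hc hr hy hx h
  have ho' := S.outer_of_notMem hc hr hy hx' h'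
  obtain ⟨z, h1, h2⟩ := exists_conj_commute hc.prime (default : Sylow s G).2 (S.outer_not_dvd hc ho)
  obtain ⟨g, rfl⟩ := isConj_iff.1 h1
  have h3 := h2 _ (S.outer_mem_sylow (S.outer_conj ho' (isConj_iff.2 ⟨g, rfl⟩)) default)
  have h4 := h3.map (MulAut.conj g⁻¹)
  simp only [MulAut.conj_apply, inv_inv] at h4
  simpa [mul_assoc] using h4.symm

/-- The central translates of a non-central primary element. -/
lemma center_translates {t : ℕ} (ht : t.Prime) (htp : t ≠ p) {x z₁ z₂ : G} (hx : IsPrimary t x)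
    (hxc : x ∉ center G) (h₁ : z₁ ∈ center G) (h₂ : z₂ ∈ center G) (hp₁ : ¬ p ∣ orderOf z₁)
    (hp₂ : ¬ p ∣ orderOf z₂) (ht₁ : ¬ IsPrimary t z₁) (ht₂ : ¬ IsPrimary t z₂) :
    IsPrimary t (z₁⁻¹ * z₂) := by
  have hcomm : ∀ z ∈ center G, ∀ g, Commute z g := fun z hz g => (mem_center_iff.1 hz g).symm
  have hv : ∀ z ∈ center G, ¬ p ∣ orderOf z → IsVert p (x * z) := by
    intro z hz hzp
    refine ⟨fun h => ?_, fun h => hxc ((mul_mem_cancel_right hz).1 h)⟩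
    have h1 := h.trans (((hcomm z hz x).symm.orderOf_mul_dvd_mul_orderOf))
    exact ((S.prime.dvd_mul.1 h1).elim (hx.not_dvd ht S.prime htp) hzp)
  -- Cancelling `u` makes `x` conjugate to `x * (v * u⁻¹)`, again a `t`-element.
  have key : ∀ u ∈ center G, ∀ v ∈ center G, IsConj (x * u) (x * v) → IsPrimary t (u⁻¹ * v) := by
    intro u hu v hv h
    obtain ⟨g, hg⟩ := isConj_iff.1 h
    have e : g * x * g⁻¹ = x * (v * u⁻¹) := by
      have : g * (x * u) * g⁻¹ = g * x * g⁻¹ * u := by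
        rw [mul_assoc, mul_assoc, (hcomm u hu g⁻¹).eq]; group
      rw [this] at hg
      rw [← mul_assoc, ← hg]; group
    have h1 : IsPrimary t (x * (v * u⁻¹)) := e ▸ hx.conj (isConj_iff.2 ⟨g, rfl⟩)
    have h2 : u⁻¹ * v = x⁻¹ * (x * (v * u⁻¹)) := by
      rw [inv_mul_cancel_left]; exact hcomm _ (inv_mem hu) _
    rw [h2]
    refine hx.inv.mul ht h1 ?_
    exact ((Commute.refl x).mul_right (hcomm _ (mul_mem hv (inv_mem hu)) x).symm).inv_left
  obtain ⟨q, hq, hqd⟩ := exists_prime_dvd hxc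
  rcases S.tri q hq x (x * z₁) (x * z₂) (hx.isVert S.prime ht htp hxc) (hv z₁ h₁ hp₁) (hv z₂ h₂ hp₂)
    hqd (by rwa [classSize_mul_center h₁]) (by rwa [classSize_mul_center h₂]) with k | k | k
  · exact absurd (by simpa using key 1 (one_mem _) z₁ h₁ (by simpa using k)) ht₁
  · exact absurd (by simpa using key 1 (one_mem _) z₂ h₂ (by simpa using k)) ht₂
  · exact key z₁ h₁ z₂ h₂ k

lemma odd_center {s r : ℕ} {c y : G} (hc : Outer p A s c) (hr : r ≠ s) (hy : Inner p A r y)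
    {w : ℕ} (hw : w.Prime) (hwp : w ≠ p) (hw2 : w ≠ 2) {z : G} (hz : z ∈ center G)
    (hzw : IsPrimary w z) : z = 1 := by
  by_contra h1
  obtain ⟨t, x, ht, htp, htw, hx, hxc⟩ : ∃ t x, t.Prime ∧ t ≠ p ∧ w ≠ t ∧ IsPrimary t x ∧
      x ∉ center G := by
    by_cases h : w = s
    · exact ⟨r, y, hy.prime, hy.ne, h ▸ hr.symm, hy.primary, hy.notMem⟩
    · exact ⟨s, c, hc.prime, hc.ne, h, hc.primary, hc.notMem⟩
  have hpz := hzw.not_dvd hw S.prime hwp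
  have hnt : ∀ u : G, IsPrimary w u → u ≠ 1 → ¬ IsPrimary t u :=
    fun u hu hu1 hu2 => hu1 (hu.eq_one hw ht htw hu2)
  -- Applied to `z` and `z⁻¹`, this makes `z⁻²` both a `w`-element and a `t`-element, so `z ^ 2 =
  -- 1`.
  have h2 := S.center_translates ht htp hx hxc hz (inv_mem hz) hpz (by rwa [orderOf_inv])
    (hnt z hzw h1) (hnt _ hzw.inv (inv_ne_one.2 h1))
  refine hnt _ (hzw.inv.mul hw hzw.inv (Commute.refl _)) (fun h3 => hw2 ?_) h2
  have h4 : z ^ 2 = 1 := by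
    rw [← inv_eq_one, ← inv_pow, pow_two, h3]
  exact (Nat.prime_dvd_prime_iff_eq hw Nat.prime_two).1
    ((hzw.dvd h1).trans (orderOf_dvd_of_pow_eq_one h4))

lemma center_unique {s r : ℕ} {c y : G} (hc : Outer p A s c) (hr : r ≠ s) (hy : Inner p A r y)
    {z₁ z₂ : G} (h₁ : z₁ ∈ center G) (h₂ : z₂ ∈ center G) (hp₁ : ¬ p ∣ orderOf z₁)
    (hp₂ : ¬ p ∣ orderOf z₂) (hne₁ : z₁ ≠ 1) (hne₂ : z₂ ≠ 1) : z₁ = z₂ := by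
  have h2 : ∀ z ∈ center G, ¬ p ∣ orderOf z → IsPrimary 2 z := by
    intro z hz hpz
    refine ⟨_, Nat.eq_prime_pow_of_unique_prime_dvd (orderOf_pos z).ne' fun {w} hw hwd => ?_⟩
    by_contra hw2
    obtain ⟨m, hm⟩ := hwd
    have hm0 : m ≠ 0 := by rintro rfl; exact (orderOf_pos z).ne' (by simpa using hm)
    have ho : orderOf (z ^ m) = w := by
      rw [orderOf_pow_of_dvd hm0 ⟨w, by rw [hm, mul_comm]⟩, hm]
      exact Nat.mul_div_cancel _ (Nat.pos_of_ne_zero hm0)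
    have h3 := S.odd_center hc hr hy hw (fun h => hpz (h ▸ ⟨m, hm⟩)) hw2 (pow_mem hz m)
      ⟨1, by rw [ho, pow_one]⟩
    rw [h3, orderOf_one] at ho
    exact hw.one_lt.ne ho
  obtain ⟨t, x, ht, htp, htw, hx, hxc⟩ : ∃ t x, t.Prime ∧ t ≠ p ∧ 2 ≠ t ∧ IsPrimary t x ∧
      x ∉ center G := by
    by_cases h : 2 = s
    · exact ⟨r, y, hy.prime, hy.ne, h ▸ hr.symm, hy.primary, hy.notMem⟩
    · exact ⟨s, c, hc.prime, hc.ne, h, hc.primary, hc.notMem⟩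
  have hnt : ∀ u : G, IsPrimary 2 u → u ≠ 1 → ¬ IsPrimary t u :=
    fun u hu hu1 hu2 => hu1 (hu.eq_one Nat.prime_two ht htw hu2)
  have hz₁ := h2 _ h₁ hp₁
  have hz₂ := h2 _ h₂ hp₂
  have h3 := S.center_translates ht htp hx hxc h₁ h₂ hp₁ hp₂ (hnt _ hz₁ hne₁) (hnt _ hz₂ hne₂)
  have h4 : IsPrimary 2 (z₁⁻¹ * z₂) :=
    hz₁.inv.mul Nat.prime_two hz₂ (mem_center_iff.1 h₂ _)
  exact inv_mul_eq_one.1 (h4.eq_one Nat.prime_two ht htw h3)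

/-- The primes dividing the order of `H` are those of the inner and outer elements. -/
lemma prime_dvd_card {s r : ℕ} {c y : G} (hc : Outer p A s c) (hr : r ≠ s) (hy : Inner p A r y)
    {w : ℕ} (hw : w.Prime) (hwp : w ≠ p) (hws : w ≠ s) (hwr : w ≠ r) : ¬ w ∣ Nat.card H := by
  intro hd
  have hcent : ∀ x : G, IsPrimary w x → x ∈ center G := by
    intro x hx
    by_contra h
    exact hwr (S.inner_unique hc hr hy hws (S.inner_of_ne hc hw hwp hws hx h))
  have := Fact.mk hw
  obtain ⟨⟨z, hz⟩, ho⟩ := exists_prime_orderOf_dvd_card' w hd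
  rw [Subgroup.orderOf_mk] at ho
  have hzw : IsPrimary w z := ⟨1, by rw [ho, pow_one]⟩
  have hz1 : z ≠ 1 := by rintro rfl; rw [orderOf_one] at ho; exact hw.one_lt.ne ho
  have hw2 : w = 2 := by
    by_contra h
    exact hz1 (S.odd_center hc hr hy hw hwp h (hcent z hzw) hzw)
  subst hw2
  have hsd := S.outer_dvd_inner hr hy hc
  have hcl := classSize_mul_center (x := y) (hcent z hzw)
  have hyz : Commute y z := mem_center_iff.1 (hcent z hzw) y
  have hpr : ¬ IsPrimary r (y * z) := fun h => hz1 (by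
    have e : z = y⁻¹ * (y * z) := by group
    refine hzw.eq_one hw hy.prime hwr ?_
    rw [e]
    exact hy.primary.inv.mul hy.prime h ((Commute.refl y).mul_right hyz).inv_left)
  have hyi : y⁻¹ ∉ center G := fun h => hy.notMem (by simpa using inv_mem h)
  have hreal : IsConj y y⁻¹ := by
    -- Only `y` and `y⁻¹` can be conjugate, as `y * z` is not an `r`-element. A real class without
    -- involutions has even size, so there is a non-central 2-element, contradicting `hcent`.
    rcases S.tri s hc.prime y y⁻¹ (y * z) (hy.isVert S.prime)
      (hy.primary.inv.isVert S.prime hy.prime hy.ne hyi)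
      (S.isVert_mul hy.prime hw hy.ne hwp hwr.symm hy.primary hzw hyz hy.notMem)
      hsd (by rwa [classSize_inv]) (by rwa [hcl]) with k | k | k
    · exact k
    · exact absurd (hy.primary.conj k) hpr
    · exact absurd (hy.primary.inv.conj k) hpr
  have hsq : y ^ 2 ≠ 1 := by
    intro h
    refine hy.notMem ?_
    have : IsPrimary 2 y := isPrimary_of_pow_eq_one hw (k := 1) (by simpa using h)
    rw [this.eq_one hw hy.prime hwr hy.primary]
    exact one_mem _
  obtain ⟨x, hx, hxc⟩ := exists_primary_notMem_center hw (two_dvd_classSize hreal hsq)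
  exact hxc (hcent x hx)

end Split

end PRegularGraph

/-! ### Commutativity of the Sylow `r`-subgroups. -/

namespace PRegularGraph

open Subgroup

lemma mem_sylow_of_commute {K : Type*} [Group K] {r : ℕ} (R : Sylow r K) {z : K}
    (hz : IsPrimary r z) (h : ∀ u ∈ R, Commute u z) : z ∈ R := by
  have h1 : (R : Subgroup K) ≤ normalizer (zpowers z : Set K) := by
    refine le_trans (fun u hu => ?_) (centralizer_le_normalizer _)
    rw [mem_centralizer_iff]
    rintro _ ⟨n, rfl⟩
    exact ((h u hu).zpow_right n).symm
  have h2 := R.3 (R.2.to_sup_of_normal_right' hz.isPGroup h1) le_sup_left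
  have h3 : z ∈ (R : Subgroup K) ⊔ zpowers z := mem_sup_right (mem_zpowers z)
  rw [h2] at h3
  exact h3

/-- If a Sylow subgroup meets a normal subgroup of prime power index in an abelian group and its
elements have classes of size prime to `r`, then it is abelian. -/
lemma sylow_commute_of_index_pow {K : Type*} [Group K] [Finite K] {r : ℕ} (hr : r.Prime)
    (R : Sylow r K) (M : Subgroup K) [M.Normal] (hM : ∃ j, M.index = r ^ j)
    (hR : ∀ x ∈ R, ¬ r ∣ classSize x)
    (hcomm : ∀ x ∈ R, x ∈ M → ∀ y ∈ R, y ∈ M → Commute x y) {x y : K} (hx : x ∈ R) (hy : y ∈ R) :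
    Commute x y := by
  have := Fact.mk hr
  have htop : (R : Subgroup K) ⊔ M = ⊤ := by
    rw [← index_eq_one]
    obtain ⟨j, hj⟩ := hM
    have h1 : ((R : Subgroup K) ⊔ M).index ∣ r ^ j := hj ▸ index_dvd_of_le le_sup_right
    have h2 : ((R : Subgroup K) ⊔ M).index ∣ (R : Subgroup K).index := index_dvd_of_le le_sup_left
    refine Nat.eq_one_of_dvd_coprimes (Nat.Coprime.pow_left j ?_) h1 h2
    exact (Nat.Prime.coprime_iff_not_dvd hr).2 R.not_dvd_index
  -- Some conjugate of `x` centralizes `R`. As the whole group is `R M`, the conjugating element can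
  -- be taken in `M`, so the result is congruent to `x` modulo `M`. Hence `R = Z(R) (R ∩ M)`.
  have key : ∀ x ∈ R, ∃ z, z ∈ R ∧ (∀ u ∈ R, Commute u z) ∧ z⁻¹ * x ∈ M := by
    intro x hx
    obtain ⟨x', h1, h2⟩ := exists_conj_commute hr R.2 (hR x hx)
    obtain ⟨g, rfl⟩ := isConj_iff.1 h1
    obtain ⟨ρ, hρ, m, hm, rfl⟩ := mem_sup_of_normal_right.1 (htop ▸ mem_top g : g ∈ (R : Subgroup K) ⊔ M)
    have h3 : ∀ u ∈ R, Commute u (m * x * m⁻¹) := by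
      intro u hu
      have h4 := (h2 _ (mul_mem (mul_mem hρ hu) (inv_mem hρ))).map (MulAut.conj ρ⁻¹)
      simp only [MulAut.conj_apply, inv_inv] at h4
      have e1 : ρ⁻¹ * (ρ * u * ρ⁻¹) * ρ = u := by group
      have e2 : ρ⁻¹ * (ρ * m * x * (ρ * m)⁻¹) * ρ = m * x * m⁻¹ := by group
      rwa [e1, e2] at h4
    refine ⟨m * x * m⁻¹, mem_sylow_of_commute R ?_ h3, h3, ?_⟩
    · exact (R.2.isPrimary hr hx).conj (isConj_iff.2 ⟨m, rfl⟩)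
    · have e : (m * x * m⁻¹)⁻¹ * x = m * (x⁻¹ * m⁻¹ * x⁻¹⁻¹) := by group
      rw [e]
      exact mul_mem hm (Normal.conj_mem ‹_› _ (inv_mem hm) _)
  obtain ⟨z, hz, hz1, hz2⟩ := key x hx
  obtain ⟨w, hw, hw1, hw2⟩ := key y hy
  have h1 := hcomm _ (mul_mem (inv_mem hz) hx) hz2 _ (mul_mem (inv_mem hw) hy) hw2
  have h2 : Commute x (w * (w⁻¹ * y)) := by
    refine (hw1 x hx).mul_right ?_
    have : Commute (z * (z⁻¹ * x)) (w⁻¹ * y) :=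
      (hz1 _ (mul_mem (inv_mem hw) hy)).symm.mul_left h1
    rwa [mul_inv_cancel_left] at this
  rwa [mul_inv_cancel_left] at h2

variable {G : Type*} [Group G] [Finite G]

lemma classSize_subtype_dvd (K : Subgroup G) [K.Normal] (x : K) :
    classSize x ∣ classSize (x : G) := by
  have e : centralizer {x} = (centralizer {(x : G)}).subgroupOf K := by
    ext u
    rw [mem_subgroupOf, mem_centralizer_single, mem_centralizer_single]
    exact ⟨fun h => congrArg Subtype.val h, fun h => Subtype.ext h⟩
  rw [classSize, e]
  exact relIndex_dvd_index_of_normal_right _ _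

/-- In a `p`-separable `{p, s, r}`-group with a normal Sylow `s`-subgroup, the Sylow `r`-subgroups
are abelian if all their elements have class sizes prime to `r`. -/
lemma sylow_commute {p s r : ℕ} (hs : s.Prime) (hr : r.Prime) (hrp : r ≠ p)
    (hp : p.Prime) (hrs : r ≠ s) (hG : IsPSeparable p G)
    (hcard : ∀ w : ℕ, w.Prime → w ∣ Nat.card G → w = p ∨ w = s ∨ w = r)
    (P : Sylow s G) [(P : Subgroup G).Normal] (R : Sylow r G) (hR : ∀ x ∈ R, ¬ r ∣ classSize x)
    {x y : G} (hx : x ∈ R) (hy : y ∈ R) : Commute x y := by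
  have := Fact.mk hr
  have := Fact.mk hs
  obtain ⟨n, N, h0, hn, hnorm, hstep⟩ := hG
  -- Joining the series with the normal subgroup `P` absorbs the prime `s`, so each step has index a
  -- power of `p` or of `r`. A step of `p`-power index adds no `r`-elements.
  have key : ∀ i ≤ n, ∀ x ∈ R, x ∈ N i ⊔ P → ∀ y ∈ R, y ∈ N i ⊔ P → Commute x y := by
    intro i
    induction i with
    | zero =>
      intro _ x hx hxM y _ _
      rw [h0, bot_sup_eq] at hxM
      rw [(P.2.isPrimary hs hxM).eq_one hs hr hrs.symm (R.2.isPrimary hr hx)]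
      exact Commute.one_left y
    | succ i ih =>
      intro hi x hx hxM y hy hyM
      have ih' := ih (by omega)
      have hN1 := hnorm i (by omega)
      have hN2 := hnorm (i + 1) hi
      obtain ⟨hle, hfac⟩ := hstep i (by omega)
      set M := N i ⊔ P with hM
      set K := N (i + 1) ⊔ P with hK
      have hMK : M ≤ K := sup_le_sup_right hle _
      have hrel : M.relIndex K ∣ (N i).relIndex (N (i + 1)) := by
        have : K = N (i + 1) ⊔ M := by
          rw [hM, hK, ← sup_assoc, sup_eq_left.2 hle]
        rw [this, relIndex_sup_right]
        exact relIndex_dvd_of_le_left _ le_sup_left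
      have hpow : (∃ k, M.relIndex K = p ^ k) ∨ ∃ k, M.relIndex K = r ^ k := by
        rcases hfac with ⟨k, hk⟩ | hk
        · left
          obtain ⟨j, -, hj⟩ := (Nat.dvd_prime_pow hp).1 (hk ▸ hrel)
          exact ⟨j, hj⟩
        · right
          refine ⟨_, Nat.eq_prime_pow_of_unique_prime_dvd index_ne_zero_of_finite fun {w} hw hwd => ?_⟩
          have h1 : M.relIndex K ∣ M.index := relIndex_dvd_index_of_le hMK
          rcases hcard w hw (hwd.trans (h1.trans (index_dvd_card M))) with rfl | rfl | rfl
          · exact absurd (hwd.trans hrel) hk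
          · exact absurd (hwd.trans (h1.trans (index_dvd_of_le le_sup_right))) P.not_dvd_index
          · rfl
      rcases hpow with ⟨k, hk⟩ | hk
      · have hmem : ∀ x ∈ R, x ∈ K → x ∈ M := by
          intro x hx hxK
          have h1 := pow_index_mem (M.subgroupOf K) (⟨x, hxK⟩ : K)
          rw [← relIndex, hk, mem_subgroupOf] at h1
          obtain ⟨j, hj⟩ := R.2.isPrimary hr hx
          obtain ⟨m, hm⟩ := exists_pow_eq_self_of_coprime (x := x) (n := p ^ k)
            (by rw [hj]; exact Nat.Coprime.pow _ _ ((Nat.coprime_primes hp hr).2 hrp.symm))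
          rw [← hm]
          exact pow_mem h1 m
        exact ih' x hx (hmem x hx hxM) y hy (hmem y hy hyM)
      · have hRK : IsPGroup r ((R : Subgroup G).subgroupOf K) := R.2.comap_subtype
        let RK : Sylow r K := hRK.toSylow fun h =>
          R.not_dvd_index (h.trans (relIndex_dvd_index_of_normal_right (R : Subgroup G) K))
        have h1 : Commute (⟨x, hxM⟩ : K) ⟨y, hyM⟩ := by
          refine sylow_commute_of_index_pow hr RK (M.subgroupOf K) hk ?_ ?_ (x := ⟨x, hxM⟩)
            (y := ⟨y, hyM⟩) hx hy
          · exact fun u hu hd => hR u hu (hd.trans (classSize_subtype_dvd K u))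
          · exact fun u hu huM v hv hvM => Subtype.ext (ih' u hu huM v hv hvM)
        exact congrArg Subtype.val h1
  exact key n le_rfl x hx (by rw [hn]; simp) y hy (by rw [hn]; simp)

end PRegularGraph

/-! ### The Frobenius structure modulo the center. -/

namespace PRegularGraph

open Subgroup

/-- The structure shared by the `p`-complements: the elements of `s`-power order and the Sylow
`r`-subgroups commute among themselves, while non-central elements of these two kinds never
commute with each other. -/
structure IsSplitPair (s r : ℕ) (X : Type*) [Group X] : Prop where
  prime_s : s.Prime
  prime_r : r.Prime
  ne : s ≠ r
  primes : ∀ w : ℕ, w.Prime → w ∣ Nat.card X → w = s ∨ w = r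
  comm_s : ∀ x y : X, IsPrimary s x → IsPrimary s y → Commute x y
  comm_r : ∀ R : Sylow r X, ∀ x ∈ R, ∀ y ∈ R, Commute x y
  central : ∀ x y : X, IsPrimary s x → IsPrimary r y → y ∉ center X → Commute x y → x ∈ center X
  exists_s : ∃ x : X, IsPrimary s x ∧ x ∉ center X
  exists_r : ∃ x : X, IsPrimary r x ∧ x ∉ center X

namespace IsSplitPair

variable {s r : ℕ} {X : Type*} [Group X] [Finite X] (S : IsSplitPair s r X)
include S

lemma mem_sylow (P : Sylow s X) {x : X} (hx : IsPrimary s x) : x ∈ P :=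
  mem_sylow_of_commute P hx fun u hu => S.comm_s u x (P.2.isPrimary S.prime_s hu) hx

lemma sylow_normal (P : Sylow s X) : (P : Subgroup X).Normal :=
  ⟨fun x hx g => S.mem_sylow P ((P.2.isPrimary S.prime_s hx).conj (isConj_iff.2 ⟨g, rfl⟩))⟩

lemma exists_mul (P : Sylow s X) (R : Sylow r X) (g : X) : ∃ u ∈ P, ∃ v ∈ R, g = u * v := by
  have := Fact.mk S.prime_s
  have := Fact.mk S.prime_r
  have := S.sylow_normal P
  have htop : (P : Subgroup X) ⊔ R = ⊤ := by
    rw [← index_eq_one]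
    by_contra h
    obtain ⟨w, hw, hd⟩ := Nat.exists_prime_and_dvd h
    rcases S.primes w hw (hd.trans (index_dvd_card _)) with rfl | rfl
    · exact P.not_dvd_index (hd.trans (index_dvd_of_le le_sup_left))
    · exact R.not_dvd_index (hd.trans (index_dvd_of_le le_sup_right))
  obtain ⟨u, hu, v, hv, h⟩ := mem_sup_of_normal_left.1 (htop ▸ mem_top g : g ∈ (P : Subgroup X) ⊔ R)
  exact ⟨u, hu, v, hv, h.symm⟩

lemma exists_mem_sylow (R : Sylow r X) : ∃ y ∈ R, y ∉ center X := by
  have := Fact.mk S.prime_r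
  obtain ⟨y, hy, hyc⟩ := S.exists_r
  obtain ⟨y', h1, h2⟩ := hy.exists_conj_mem S.prime_r R.not_dvd_index
  exact ⟨y', h1, fun h => hyc (mem_center_conj h2.symm h)⟩

/-- An `s`-element that agrees with an element of a Sylow `r`-subgroup modulo the center is central. -/
lemma mem_center_of_mk_eq (R : Sylow r X) {u v : X} (hu : IsPrimary s u) (hv : v ∈ R)
    (h : (u : X ⧸ center X) = v) : u ∈ center X := by
  obtain ⟨y, hy, hyc⟩ := S.exists_mem_sylow R
  refine S.central u y hu (R.2.isPrimary S.prime_r hy) hyc ?_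
  have h1 : Commute (v⁻¹ * u) y := (mem_center_iff.1 (QuotientGroup.eq.1 h.symm) y).symm
  have h2 := (S.comm_r R v hv y hy).mul_left h1
  rwa [mul_inv_cancel_left] at h2

/-- If `u` commutes with the non-central element `v` modulo the center, it is central. -/
lemma mem_center_of_commute_mk {u v : X} (hu : IsPrimary s u) (hv : IsPrimary r v)
    (hvc : v ∉ center X) (h : (u : X ⧸ center X) * v * (u : X ⧸ center X)⁻¹ = v) :
    u ∈ center X := by
  have hk : u * v * u⁻¹ * v⁻¹ ∈ center X := by
    rw [← QuotientGroup.eq_one_iff, QuotientGroup.mk_mul, QuotientGroup.mk_mul, QuotientGroup.mk_mul,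
      QuotientGroup.mk_inv, QuotientGroup.mk_inv, h, mul_inv_cancel]
  have h1 : IsPrimary s (u * v * u⁻¹ * v⁻¹) := by
    have h2 : IsPrimary s (v * u⁻¹ * v⁻¹) := hu.inv.conj (isConj_iff.2 ⟨v, rfl⟩)
    have e : u * v * u⁻¹ * v⁻¹ = u * (v * u⁻¹ * v⁻¹) := by group
    rw [e]
    exact hu.mul S.prime_s h2 (S.comm_s _ _ hu h2)
  have h2 : IsPrimary r (u * v * u⁻¹ * v⁻¹) := by
    have h3 : IsPrimary r (u * v * u⁻¹) := hv.conj (isConj_iff.2 ⟨u, rfl⟩)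
    refine h3.mul S.prime_r hv.inv ?_
    have h4 : Commute (u * v * u⁻¹ * v⁻¹) v := (mem_center_iff.1 hk v).symm
    have h5 := h4.mul_left (Commute.refl v)
    rw [inv_mul_cancel_right] at h5
    exact h5.inv_right
  have h3 := h1.eq_one S.prime_s S.prime_r S.ne h2
  exact S.central u v hu hv hvc (mul_inv_eq_iff_eq_mul.1 (mul_inv_eq_one.1 h3))

/-- Since the group is `P R` with `R` abelian, only conjugation by `u ∈ P` matters. The commutator
of `u` and `v` is then an `s`-element lying in `R` modulo the center, hence central, which forces
`u` or `v` to be central. -/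
lemma isFrobeniusComplement (R : Sylow r X) :
    IsFrobeniusComplement ((R : Subgroup X).map (QuotientGroup.mk' (center X))) := by
  obtain ⟨y, hy, hyc⟩ := S.exists_mem_sylow R
  let P : Sylow s X := default
  have hPn := S.sylow_normal P
  refine ⟨fun h => ?_, fun h => ?_, ?_⟩
  · have h1 : (y : X ⧸ center X) ∈ (R : Subgroup X).map (QuotientGroup.mk' (center X)) :=
      mem_map_of_mem _ hy
    rw [h, mem_bot, QuotientGroup.eq_one_iff] at h1
    exact hyc h1
  · obtain ⟨c, hc, hcc⟩ := S.exists_s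
    obtain ⟨v, hv, h1⟩ := (h ▸ mem_top _ :
      (c : X ⧸ center X) ∈ (R : Subgroup X).map (QuotientGroup.mk' (center X)))
    exact hcc (S.mem_center_of_mk_eq R hc hv h1.symm)
  · intro g hg x hx hgx
    obtain ⟨g, rfl⟩ := QuotientGroup.mk_surjective g
    obtain ⟨v, hv, rfl⟩ := hx
    obtain ⟨v', hv', h1⟩ := hgx
    by_contra hne
    have hvc : v ∉ center X := fun h => hne ((QuotientGroup.eq_one_iff v).2 h)
    obtain ⟨u, hu, w, hw, rfl⟩ := S.exists_mul P R g
    have hus := P.2.isPrimary S.prime_s hu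
    have e : u * w * v * (u * w)⁻¹ = u * v * u⁻¹ := by
      rw [mul_assoc u w v, (S.comm_r R w hw v hv).eq]; group
    change (v' : X ⧸ center X) = ((u * w * v * (u * w)⁻¹ : X) : X ⧸ center X) at h1
    rw [e] at h1
    have h2 : u * v * u⁻¹ * v⁻¹ ∈ center X := by
      refine S.mem_center_of_mk_eq R (v := v' * v⁻¹) (P.2.isPrimary S.prime_s ?_)
        (mul_mem hv' (inv_mem hv)) ?_
      · have e : u * v * u⁻¹ * v⁻¹ = u * (v * u⁻¹ * v⁻¹) := by group
        rw [e]
        exact mul_mem hu (hPn.conj_mem _ (inv_mem hu) v)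
      · rw [QuotientGroup.mk_mul, ← h1, QuotientGroup.mk_mul]
    have h3 : u ∈ center X := by
      refine S.mem_center_of_commute_mk hus (R.2.isPrimary S.prime_r hv) hvc ?_
      rw [← QuotientGroup.eq_one_iff, QuotientGroup.mk_mul, QuotientGroup.mk_inv, mul_inv_eq_one]
        at h2
      exact h2
    refine hg ⟨w, hw, ?_⟩
    change ((w : X) : X ⧸ center X) = ((u * w : X) : X ⧸ center X)
    rw [QuotientGroup.mk_mul, (QuotientGroup.eq_one_iff u).2 h3, one_mul]

lemma isFrobeniusKernel (P : Sylow s X) :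
    IsFrobeniusKernel ((P : Subgroup X).map (QuotientGroup.mk' (center X))) := by
  let R : Sylow r X := default
  have hPn := S.sylow_normal P
  refine ⟨_, S.isFrobeniusComplement R, fun x => ⟨?_, ?_⟩⟩
  · rintro ⟨u, hu, rfl⟩
    by_contra! h
    obtain ⟨h1, g, v, hv, h2⟩ := h
    obtain ⟨g, rfl⟩ := QuotientGroup.mk_surjective g
    have h3 : IsConj u (g * u * g⁻¹) := isConj_iff.2 ⟨g, rfl⟩
    have h4 := S.mem_center_of_mk_eq R ((P.2.isPrimary S.prime_s hu).conj h3) hv h2.symm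
    exact h1 ((QuotientGroup.eq_one_iff u).2 (mem_center_conj h3.symm h4))
  · rintro (rfl | h)
    · exact one_mem _
    obtain ⟨x, rfl⟩ := QuotientGroup.mk_surjective x
    obtain ⟨u, hu, v, hv, rfl⟩ := S.exists_mul P R x
    by_cases hvc : v ∈ center X
    · refine ⟨u, hu, ?_⟩
      change (u : X ⧸ center X) = ((u * v : X) : X ⧸ center X)
      rw [QuotientGroup.mk_mul, (QuotientGroup.eq_one_iff v).2 hvc, mul_one]
    exfalso
    set K := (P : Subgroup X).map (QuotientGroup.mk' (center X)) with hK
    have hKn : K.Normal := hPn.map _ (QuotientGroup.mk'_surjective _)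
    -- For non-central `v`, the map `k ↦ k * (v * k⁻¹ * v⁻¹)` is injective on the finite group `K`,
    -- hence surjective. Solving it for `u` conjugates `u * v` to `v`.
    let f : K → K := fun k => ⟨k * (v * (k : X ⧸ center X)⁻¹ * (v : X ⧸ center X)⁻¹),
      mul_mem k.2 (hKn.conj_mem _ (inv_mem k.2) _)⟩
    have hf : Function.Injective f := by
      rintro ⟨_, a, ha, rfl⟩ ⟨_, b, hb, rfl⟩ hab
      have h1 : (a : X ⧸ center X) * (v * (a : X ⧸ center X)⁻¹ * (v : X ⧸ center X)⁻¹) =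
          b * (v * (b : X ⧸ center X)⁻¹ * (v : X ⧸ center X)⁻¹) := congrArg Subtype.val hab
      have h2 : b⁻¹ * a ∈ center X := by
        refine S.mem_center_of_commute_mk (P.2.isPrimary S.prime_s (mul_mem (inv_mem hb) ha))
          (R.2.isPrimary S.prime_r hv) hvc ?_
        rw [QuotientGroup.mk_mul, QuotientGroup.mk_inv]
        calc _ = (b : X ⧸ center X)⁻¹ * ((a : X ⧸ center X) *
              (v * (a : X ⧸ center X)⁻¹ * (v : X ⧸ center X)⁻¹)) * v * b := by group
          _ = _ := by rw [h1]; group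
      exact Subtype.ext (QuotientGroup.eq.2 h2).symm
    obtain ⟨k, hk⟩ := (Finite.injective_iff_surjective.1 hf) ⟨u, mem_map_of_mem _ hu⟩
    have hk' : (k : X ⧸ center X) * (v * (k : X ⧸ center X)⁻¹ * (v : X ⧸ center X)⁻¹) = u :=
      congrArg Subtype.val hk
    refine h (k : X ⧸ center X)⁻¹ ⟨v, hv, ?_⟩
    change (v : X ⧸ center X) = (k : X ⧸ center X)⁻¹ * (u * v) * ((k : X ⧸ center X)⁻¹)⁻¹
    rw [← hk']; group

lemma isQuasiFrobenius : IsQuasiFrobenius X := ⟨_, S.isFrobeniusComplement default⟩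

lemma exists_abelian_kernel :
    ∃ K : Subgroup X, IsQuasiFrobeniusKernel K ∧ ∀ x ∈ K, ∀ y ∈ K, x * y = y * x := by
  let P : Sylow s X := default
  refine ⟨_, ⟨_, S.isFrobeniusKernel P, rfl⟩, ?_⟩
  rintro x ⟨u, hu, h1⟩ y ⟨v, hv, h2⟩
  have hx : u⁻¹ * x ∈ center X := QuotientGroup.eq.1 h1
  have hy : v⁻¹ * y ∈ center X := QuotientGroup.eq.1 h2
  have h3 : Commute u v := S.comm_s u v (P.2.isPrimary S.prime_s hu) (P.2.isPrimary S.prime_s hv)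
  have h4 : Commute u (v * (v⁻¹ * y)) := h3.mul_right (mem_center_iff.1 hy u)
  have h5 : Commute (u * (u⁻¹ * x)) (v * (v⁻¹ * y)) :=
    h4.mul_left (mem_center_iff.1 hx _).symm
  simpa using h5.eq

lemma abelian_complement {L : Subgroup X} (hL : IsQuasiFrobeniusComplement L) :
    ∀ x ∈ L, ∀ y ∈ L, x * y = y * x := by
  have := Fact.mk S.prime_s
  obtain ⟨M, hM, rfl⟩ := hL
  let P : Sylow s X := default
  let R : Sylow r X := default
  have hPn := S.sylow_normal P
  -- A non-trivial element of `P` in the complement would pull in all of `P`, which is abelian, and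
  -- then the whole group, as `P` is normal.
  have hPM : ∀ u ∈ P, (u : X ⧸ center X) ∈ M → u ∈ center X := by
    intro u hu huM
    by_contra huc
    have hu1 : (u : X ⧸ center X) ≠ 1 := fun h => huc ((QuotientGroup.eq_one_iff u).1 h)
    have hP : ∀ v ∈ P, (v : X ⧸ center X) ∈ M := by
      intro v hv
      by_contra hvM
      refine hu1 (hM.inter_conj v hvM u huM ?_)
      rw [← QuotientGroup.mk_mul, ← QuotientGroup.mk_inv, ← QuotientGroup.mk_mul,
        (S.comm_s v u (P.2.isPrimary S.prime_s hv) (P.2.isPrimary S.prime_s hu)).eq,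
        mul_inv_cancel_right]
      exact huM
    refine hM.ne_top (eq_top_iff.2 fun g _ => ?_)
    obtain ⟨g, rfl⟩ := QuotientGroup.mk_surjective g
    by_contra hg
    exact hu1 (hM.inter_conj g hg u huM (hP _ (hPn.conj_mem u hu g)))
  intro x hx y hy
  have hkP : x * y * x⁻¹ * y⁻¹ ∈ P := by
    obtain ⟨a, ha, v, hv, rfl⟩ := S.exists_mul P R x
    obtain ⟨b, hb, w, hw, rfl⟩ := S.exists_mul P R y
    change _ ∈ (P : Subgroup X)
    rw [← QuotientGroup.eq_one_iff]
    have ha' : (a : X ⧸ (P : Subgroup X)) = 1 := (QuotientGroup.eq_one_iff a).2 ha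
    have hb' : (b : X ⧸ (P : Subgroup X)) = 1 := (QuotientGroup.eq_one_iff b).2 hb
    simp only [QuotientGroup.mk_mul, QuotientGroup.mk_inv, ha', hb', one_mul]
    rw [← QuotientGroup.mk_mul, (S.comm_r R v hv w hw).eq, QuotientGroup.mk_mul]
    group
  set k := x * y * x⁻¹ * y⁻¹ with hk
  have hkc : k ∈ center X := hPM k hkP
    (mul_mem (mul_mem (mul_mem hx hy) (inv_mem hx)) (inv_mem hy))
  -- Conjugation by `y⁻¹` multiplies `x` by the central element `k`. Since this power of `x` is
  -- central, the same power of `k` is 1; the exponent is prime to `s`, while `k` is an `s`-element.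
  have hxn : x ^ (P : Subgroup X).index ∈ center X :=
    hPM _ (pow_index_mem _ x) (pow_mem hx _)
  have hkx : Commute k x := (mem_center_iff.1 hkc x).symm
  have e : y⁻¹ * x * y⁻¹⁻¹ = k * x := by
    have : y⁻¹ * x * y⁻¹⁻¹ = y⁻¹ * (k * (y * x)) := by rw [hk]; group
    rw [this, ← mul_assoc k, ← mem_center_iff.1 hkc y]; group
  have h1 : k ^ (P : Subgroup X).index = 1 := by
    have h2 := congrArg (· ^ (P : Subgroup X).index) e
    simp only [conj_pow, hkx.mul_pow] at h2
    rw [mem_center_iff.1 hxn, mul_inv_cancel_right] at h2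
    exact mul_eq_right.1 h2.symm
  have h2 : k = 1 := by
    by_contra hne
    exact P.not_dvd_index (((P.2.isPrimary S.prime_s hkP).dvd hne).trans
      (orderOf_dvd_of_pow_eq_one h1))
  rw [hk, mul_inv_eq_one, mul_inv_eq_iff_eq_mul] at h2
  exact h2

end IsSplitPair

end PRegularGraph

/-! ### From the graph to the data of `Split`. -/

namespace PRegularGraph

open Subgroup

variable {G : Type*} [Group G] [Finite G] {p : ℕ}

lemma mk_mem_noncenter_iff {x : G} : ConjClasses.mk x ∈ ConjClasses.noncenter G ↔ x ∉ center G := by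
  rw [ConjClasses.mem_noncenter, ← classSize_eq_one_iff, classSize_eq_carrier,
    ← Set.one_lt_ncard_iff_nontrivial, ← Nat.card_coe_set_eq]
  have : 0 < Nat.card (ConjClasses.mk x).carrier := classSize_eq_carrier x ▸ classSize_pos x
  omega

/-- The vertex of `Γ_p(G)` given by an element. -/
def IsVert.vertex {x : G} (h : IsVert p x) : Vertex p G :=
  ⟨ConjClasses.mk x, mk_mem_noncenter_iff.2 h.2, fun _ hg =>
    orderOf_conj (ConjClasses.mk_eq_mk_iff_isConj.1 (ConjClasses.mem_carrier_iff_mk_eq.1 hg)) ▸ h.1⟩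

lemma IsVert.vertex_eq_iff {x y : G} (hx : IsVert p x) (hy : IsVert p y) :
    hx.vertex = hy.vertex ↔ IsConj x y :=
  Subtype.ext_iff.trans ConjClasses.mk_eq_mk_iff_isConj

lemma exists_vertex_eq (v : Vertex p G) : ∃ (x : G) (hx : IsVert p x), hx.vertex = v := by
  obtain ⟨v, h1, h2⟩ := v
  obtain ⟨x, rfl⟩ := ConjClasses.mk_surjective v
  exact ⟨x, ⟨h2 x ConjClasses.mem_carrier_mk, mk_mem_noncenter_iff.1 h1⟩, rfl⟩

lemma IsVert.adj_iff {x y : G} (hx : IsVert p x) (hy : IsVert p y) :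
    (commonDivisorGraph p G).Adj hx.vertex hy.vertex ↔
      ¬ IsConj x y ∧ ¬ (classSize x).Coprime (classSize y) := by
  rw [classSize_eq_carrier, classSize_eq_carrier, ← hx.vertex_eq_iff hy]
  exact Iff.rfl

lemma exists_split (hp : p.Prime) {H : Subgroup G} (hH : IsPComplement p H)
    (hdisc : ¬ (commonDivisorGraph p G).Preconnected) (htri : (commonDivisorGraph p G).CliqueFree 3) :
    ∃ (A : G → Prop) (b : G), Split p H A b := by
  obtain ⟨u, v, huv⟩ : ∃ u v, ¬ (commonDivisorGraph p G).Reachable u v := by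
    by_contra! h
    exact hdisc h
  obtain ⟨x, hx, rfl⟩ := exists_vertex_eq u
  obtain ⟨y, hy, rfl⟩ := exists_vertex_eq v
  have hvert : ∀ z ∈ H, z ∉ center G → IsVert p z := fun z hz hzc =>
    ⟨fun h => hH.1 (h.trans (Subgroup.orderOf_dvd_natCard H hz)), hzc⟩
  have hne : ∃ z ∈ H, z ∉ center G := by
    obtain ⟨t, k, ht, hd, h1, h2⟩ := exists_primary_pow hx.2
    obtain ⟨z, hz, hc⟩ := h1.exists_conj_mem ht (H := H) (fun h => by
      obtain ⟨j, hj⟩ := hH.2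
      rw [hj] at h
      exact hx.1 (((Nat.prime_dvd_prime_iff_eq ht hp).1 (ht.dvd_of_dvd_pow h)) ▸ hd))
    exact ⟨z, hz, fun h => h2 (mem_center_conj hc.symm h)⟩
  obtain ⟨b, ⟨hbH, hbc⟩, hmax⟩ := Set.exists_max_image {z : G | z ∈ H ∧ z ∉ center G} classSize
    (Set.toFinite _) (hne.imp fun z hz => hz)
  have hb := hvert b hbH hbc
  refine ⟨fun z => ∃ hz : IsVert p z, (commonDivisorGraph p G).Reachable hb.vertex hz.vertex, b,
    hp, hH.2, ?_, ?_, hbH, hb, ⟨hb, SimpleGraph.Reachable.refl _⟩, fun z hz hzc => hmax z ⟨hz, hzc⟩, ?_⟩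
  · intro t ht x y z hx hy hz h1 h2 h3
    by_contra! h
    classical
    have hnc : ∀ {a b : ℕ}, t ∣ a → t ∣ b → ¬ a.Coprime b := fun ha hb hc =>
      ht.one_lt.ne' (Nat.eq_one_of_dvd_coprimes hc ha hb)
    exact htri {hx.vertex, hy.vertex, hz.vertex} (SimpleGraph.is3Clique_triple_iff.2
      ⟨(hx.adj_iff hy).2 ⟨h.1, hnc h1 h2⟩, (hx.adj_iff hz).2 ⟨h.2.1, hnc h1 h3⟩,
        (hy.adj_iff hz).2 ⟨h.2.2, hnc h2 h3⟩⟩)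
  · rintro x y hx hy hc ⟨hx', hr⟩
    refine ⟨hy, hr.trans ?_⟩
    by_cases hconj : IsConj x y
    · rw [(hx.vertex_eq_iff hy).2 hconj]
    · exact ((hx.adj_iff hy).2 ⟨hconj, hc⟩).reachable
  · by_contra! h
    obtain ⟨_, h1⟩ := h x hx
    obtain ⟨_, h2⟩ := h y hy
    exact huv (h1.symm.trans h2)

end PRegularGraph

/-! ### Assembly of the main theorem. -/

theorem mainTheorem2 {G : Type*} [Group G] [Finite G] (p : ℕ) (hp : p.Prime)
    (hG : PRegularGraph.IsPSeparable p G)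
    (H : Subgroup G) (hH : PRegularGraph.IsPComplement p H)
    (hdisc : ¬ (PRegularGraph.commonDivisorGraph p G).Preconnected)
    (htri : (PRegularGraph.commonDivisorGraph p G).CliqueFree 3) :
    (∃ q r : ℕ, q.Prime ∧ r.Prime ∧ q ≠ p ∧ r ≠ p ∧ q ≠ r ∧
      (Nat.card H).primeFactors = {q, r}) ∧
    PRegularGraph.IsQuasiFrobenius H ∧
    (∃ K : Subgroup H, PRegularGraph.IsQuasiFrobeniusKernel K ∧ ∀ x ∈ K, ∀ y ∈ K, x * y = y * x) ∧
    (∀ L : Subgroup H, PRegularGraph.IsQuasiFrobeniusComplement L →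
      ∀ x ∈ L, ∀ y ∈ L, x * y = y * x) ∧
    (Subgroup.center H).map H.subtype = H ⊓ Subgroup.center G ∧
    (Subgroup.center H = ⊥ ∨
      (IsCyclic (Subgroup.center H) ∧ Nat.card (Subgroup.center H) = 2)) := by
  open PRegularGraph in
  obtain ⟨A, b, S⟩ := exists_split hp hH hdisc htri
  obtain ⟨s, c₀, hc₀⟩ := S.exists_outer
  obtain ⟨r, y₀, hrs, hy₀⟩ := S.exists_inner_ne hc₀
  have := Fact.mk hc₀.prime
  have := Fact.mk hy₀.prime
  obtain ⟨c, hcH, hcc⟩ := hc₀.primary.exists_conj_mem hc₀.prime (S.not_dvd_index hc₀.prime hc₀.ne)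
  obtain ⟨y, hyH, hyc⟩ := hy₀.primary.exists_conj_mem hy₀.prime (S.not_dvd_index hy₀.prime hy₀.ne)
  have hc := S.outer_conj hc₀ hcc
  have hy := S.inner_conj hy₀ hyc
  have hcoe : ∀ {t : ℕ} {x : H}, IsPrimary t x ↔ IsPrimary t (x : G) := by
    intro t x
    rw [IsPrimary, IsPrimary, Subgroup.orderOf_coe]
  have hreg : ∀ z ∈ H, ¬ p ∣ orderOf z := fun z hz h =>
    hH.1 (h.trans (Subgroup.orderOf_dvd_natCard H hz))
  have hprimes : ∀ w : ℕ, w.Prime → w ∣ Nat.card H → w = s ∨ w = r := by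
    intro w hw hwd
    by_contra! h
    exact S.prime_dvd_card hc hrs hy hw (fun e => hH.1 (e ▸ hwd)) h.1 h.2 hwd
  -- An element central in `H` but not in `G` would have a non-central power of prime power order
  -- that is inner or outer, yet commutes with both `c` and `y`.
  have hcen : ∀ z : H, z ∈ Subgroup.center H ↔ (z : G) ∈ Subgroup.center G := by
    intro z
    refine ⟨fun hz => ?_, fun hz => Subgroup.mem_center_iff.2 fun g =>
      Subtype.ext (Subgroup.mem_center_iff.1 hz g)⟩
    by_contra hzc
    have hcomm : ∀ g ∈ H, Commute (z : G) g := fun g hg =>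
      (congrArg Subtype.val (Subgroup.mem_center_iff.1 hz ⟨g, hg⟩)).symm
    obtain ⟨t, k, ht, hd, h1, h2⟩ := exists_primary_pow hzc
    rcases hprimes t ht (hd.trans (Subgroup.orderOf_dvd_natCard H z.2)) with rfl | rfl
    · exact S.not_commute hrs hy (S.outer_of_notMem hc hrs hy h1 h2)
        ((hcomm y hyH).pow_left k).symm
    · exact S.not_commute hrs (S.inner_of_ne hc ht hy.ne hrs h1 h2) hc ((hcomm c hcH).pow_left k)
  have hrR : ∀ x : G, IsPrimary r x → ¬ r ∣ classSize x := by
    intro x hx hd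
    by_cases hxc : x ∈ Subgroup.center G
    · rw [classSize_eq_one_iff.2 hxc] at hd
      exact hy.prime.one_lt.ne' (Nat.dvd_one.1 hd)
    have hxi := S.inner_of_ne hc hy.prime hy.ne hrs hx hxc
    exact hy.prime.one_lt.ne' (Nat.eq_one_of_dvd_coprimes (S.coprime_io hxi hc) hd
      (S.inner_dvd_outer hrs hxi hc))
  have hcommS : ∀ x x' : G, IsPrimary s x → IsPrimary s x' → Commute x x' := fun x x' hx hx' =>
    S.commute_of_primary hc hrs hy hx hx'
  let P : Sylow s G := default
  have hPn : (P : Subgroup G).Normal := ⟨fun x hx g => mem_sylow_of_commute P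
    ((P.2.isPrimary hc.prime hx).conj (isConj_iff.2 ⟨g, rfl⟩)) fun u hu =>
      hcommS _ _ (P.2.isPrimary hc.prime hu)
        ((P.2.isPrimary hc.prime hx).conj (isConj_iff.2 ⟨g, rfl⟩))⟩
  have hcardG : ∀ w : ℕ, w.Prime → w ∣ Nat.card G → w = p ∨ w = s ∨ w = r := by
    intro w hw hwd
    rw [← H.card_mul_index, hw.dvd_mul] at hwd
    rcases hwd with h | h
    · exact Or.inr (hprimes w hw h)
    · by_contra! h'
      exact S.not_dvd_index hw h'.1 h
  have hpair : IsSplitPair s r H := by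
    refine ⟨hc.prime, hy.prime, hrs.symm, hprimes, fun x x' hx hx' => Subtype.ext
      (hcommS _ _ (hcoe.1 hx) (hcoe.1 hx')), ?_, ?_, ⟨⟨c, hcH⟩, hcoe.2 hc.primary,
      fun h => hc.notMem ((hcen _).1 h)⟩, ⟨⟨y, hyH⟩, hcoe.2 hy.primary,
      fun h => hy.notMem ((hcen _).1 h)⟩⟩
    · intro R x hx x' hx'
      obtain ⟨T, hT⟩ := (R.2.map H.subtype).exists_le_sylow
      exact Subtype.ext (sylow_commute hc.prime hy.prime hy.ne hp hrs hG hcardG P T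
        (fun u hu => hrR u (T.2.isPrimary hy.prime hu))
        (hT (Subgroup.mem_map_of_mem _ hx)) (hT (Subgroup.mem_map_of_mem _ hx')))
    · intro x x' hx hx' hxc hcomm
      by_contra hn
      exact S.not_commute hrs
        (S.inner_of_ne hc hy.prime hy.ne hrs (hcoe.1 hx') fun h => hxc ((hcen _).2 h))
        (S.outer_of_notMem hc hrs hy (hcoe.1 hx) fun h => hn ((hcen _).2 h))
        (congrArg Subtype.val hcomm.symm.eq)
  refine ⟨⟨s, r, hc.prime, hy.prime, hc.ne, hy.ne, hrs.symm, ?_⟩, hpair.isQuasiFrobenius,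
    hpair.exists_abelian_kernel, fun L hL => hpair.abelian_complement hL, ?_, ?_⟩
  · ext w
    rw [Nat.mem_primeFactors, Finset.mem_insert, Finset.mem_singleton]
    refine ⟨fun h => hprimes w h.1 h.2.1, ?_⟩
    have hdvd : ∀ {t : ℕ} {x : G}, IsPrimary t x → x ∉ Subgroup.center G → x ∈ H →
        t ∣ Nat.card H := fun hx hxc hxH =>
      (hx.dvd fun h => hxc (h ▸ one_mem _)).trans (Subgroup.orderOf_dvd_natCard H hxH)
    rintro (rfl | rfl)
    · exact ⟨hc.prime, hdvd hc.primary hc.notMem hcH, Nat.card_pos.ne'⟩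
    · exact ⟨hy.prime, hdvd hy.primary hy.notMem hyH, Nat.card_pos.ne'⟩
  · ext z
    constructor
    · rintro ⟨u, hu, rfl⟩
      exact ⟨u.2, (hcen u).1 hu⟩
    · rintro ⟨hz, hzc⟩
      exact ⟨⟨z, hz⟩, (hcen _).2 hzc, rfl⟩
  · by_cases hbot : Subgroup.center H = ⊥
    · exact Or.inl hbot
    right
    obtain ⟨z, hz1⟩ := Subgroup.ne_bot_iff_exists_ne_one.1 hbot
    have hcard : Nat.card (Subgroup.center H) = 2 := by
      rw [Nat.card_eq_two_iff' 1]
      refine ⟨z, hz1, fun u hu => ?_⟩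
      refine Subtype.ext (Subtype.ext (S.center_unique hc hrs hy ((hcen _).1 u.2) ((hcen _).1 z.2)
        (hreg _ u.1.2) (hreg _ z.1.2) (fun h => hu ?_) fun h => hz1 ?_))
      · exact Subtype.ext (Subtype.ext h)
      · exact Subtype.ext (Subtype.ext h)
    have := Fact.mk Nat.prime_two
    exact ⟨isCyclic_of_prime_card hcard, hcard⟩
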